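/- For $\lambda=(\lambda_4,\lambda_6)\in\mathcal B=\{\lambda\in\mathbb C^2:\ \Delta(\lambda)\ne 0\}$, $\Delta=4\lambda_4^3+27\lambda_6^2$, let $\Gamma(\lambda)\subset\mathbb C$ be the period lattice of the elliptic curve $y^2=x^3+\lambda_4x+\lambda_6$, i.e. the lattice with Weierstrass invariants $g_2=-4\lambda_4$, $g_3=-4\lambda_6$, and let $\wp(u;\lambda)$ and $\zeta(u;\lambda)$ be the Weierstrass functions of $\Gamma(\lambda)$. Such a lattice exists for every $\lambda\in\mathcal B$, the set $X=\{(u,\lambda):\lambda\in\mathcal B,\ u\notin\Gamma(\lambda)\}$ is open in $\mathbb C^3$, the functions $\wp$ and $\zeta$ are holomorphic on $X$, and $\partial\zeta=-\wp$, where $\partial=\partial/\partial u$. Let $\mathcal P_1$ be the ring of functions on $X$ generated over $\mathbb C$ by $\wp$ and all its $u$-derivatives $\wp',\wp'',\dots$. Put $$\ell_0=4\lambda_4\partial_{\lambda_4}+6\lambda_6\partial_{\lambda_6},\qquad \ell_2=6\lambda_6\partial_{\lambda_4}-\tfrac43\lambda_4^2\partial_{\lambda_6},$$ $$L_0=\ell_0-u\,\partial,\qquad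 L_1=\partial,\qquad L_2=\ell_2-\zeta\,\partial .$$ Let $\mathrm{Der}$ be the set of all first-order differential operators $a\,\partial_u+b\,\partial_{\lambda_4}+c\,\partial_{\lambda_6}$, with $a,b,c$ holomorphic on $X$, that map $\mathcal P_1$ into itself, and let $\mathcal L_1$ be the set of those $L\in\mathrm{Der}$ that are tangent to the discriminant, that is, $L\Delta\in\mathcal P_1\cdot\Delta$. Theorem. $\mathcal L_1$ is closed under the commutator, and as a $\mathcal P_1$-module it is generated by $L_0,L_1,L_2$. Moreover $\Delta\cdot L$ is a combination of $L_0,L_1,L_2$ with coefficients in $\mathcal P_1$ for every $L\in\mathrm{Der}$. The brackets are $$[L_0,L_1]=L_1,\qquad [L_0,L_2]=2L_2,\qquad [L_1,L_2]=\wp L_1,$$ and $$L_0\wp=2\wp,\qquad L_1\wp=\wp',\qquad L_2\wp=\tfrac23\wp''-2\wp^2 .$$ -/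

import Mathlib

open TopologicalSpace

namespace EllipticDer

noncomputable section

/-! ### Holomorphic functions on an open subset of `ℂ × ℂ × ℂ` and their derivations -/

/-- The space of the variables `(u, λ₄, λ₆)`. -/
abbrev E : Type := ℂ × ℂ × ℂ

/-- The `ℂ`-algebra of holomorphic functions on the open set `U`. -/
def Holo (U : Opens E) : Subalgebra ℂ (U → ℂ) where
  carrier := {f | ∃ F : E → ℂ, AnalyticOnNhd ℂ F U ∧ ∀ p : U, f p = F p}
  mul_mem' := by
    rintro f g ⟨F, hF, hf⟩ ⟨G, hG, hg⟩
    exact ⟨F * G, hF.mul hG, fun p => by simp [hf, hg]⟩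
  add_mem' := by
    rintro f g ⟨F, hF, hf⟩ ⟨G, hG, hg⟩
    exact ⟨F + G, hF.add hG, fun p => by simp [hf, hg]⟩
  algebraMap_mem' c := ⟨fun _ => c, fun _ _ => analyticAt_const, fun _ => rfl⟩

/-- Extension by zero of a function on `U` to the whole space. -/
def ext0 {U : Opens E} (f : U → ℂ) : E → ℂ := Function.extend Subtype.val f 0

theorem ext0_eventuallyEq {U : Opens E} {f : U → ℂ} {F : E → ℂ} (h : ∀ p : U, f p = F p)
    {p : E} (hp : p ∈ U) : ext0 f =ᶠ[nhds p] F := by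
  filter_upwards [U.isOpen.mem_nhds hp] with q hq
  have := Subtype.val_injective.extend_apply f 0 (⟨q, hq⟩ : U)
  exact this.trans (h ⟨q, hq⟩)

theorem ext0_differentiableAt {U : Opens E} (f : Holo U) (p : U) :
    DifferentiableAt ℂ (ext0 f.1) p := by
  obtain ⟨F, hF, hf⟩ := f.2
  exact ((hF p p.2).congr (ext0_eventuallyEq hf p.2).symm).differentiableAt

/-- The directional derivative along the constant vector `e`, as a derivation of the algebra of
holomorphic functions on `U`. -/
def partialD (U : Opens E) (e : E) : Derivation ℂ (Holo U) (Holo U) :=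
  Derivation.mk'
    { toFun := fun f => ⟨fun p => fderiv ℂ (ext0 f.1) p e, by
        obtain ⟨F, hF, hf⟩ := f.2
        exact ⟨fun q => fderiv ℂ F q e,
          fun q hq => ((ContinuousLinearMap.apply ℂ ℂ e).analyticAt _).comp (hF.fderiv q hq),
          fun p => by
            change fderiv ℂ (ext0 f.1) p e = fderiv ℂ F p e
            rw [(ext0_eventuallyEq hf p.2).fderiv_eq]⟩⟩
      map_add' := fun f g => by
        ext p
        have h : ext0 (f + g).1 =ᶠ[nhds (p : E)] ext0 f.1 + ext0 g.1 :=
          ext0_eventuallyEq (fun q => by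
            simp [ext0]) p.2
        change fderiv ℂ (ext0 (f + g).1) p e
          = fderiv ℂ (ext0 f.1) p e + fderiv ℂ (ext0 g.1) p e
        rw [h.fderiv_eq, fderiv_add (ext0_differentiableAt f p) (ext0_differentiableAt g p)]
        rfl
      map_smul' := fun c f => by
        ext p
        have h : ext0 (c • f).1 =ᶠ[nhds (p : E)] c • ext0 f.1 :=
          ext0_eventuallyEq (fun q => by
            simp [ext0]) p.2
        change fderiv ℂ (ext0 (c • f).1) p e = c • fderiv ℂ (ext0 f.1) p e
        rw [h.fderiv_eq, fderiv_const_smul (ext0_differentiableAt f p)]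
        rfl }
    (fun f g => by
      ext p
      have h : ext0 (f * g).1 =ᶠ[nhds (p : E)] ext0 f.1 * ext0 g.1 :=
        ext0_eventuallyEq (fun q => by
          simp [ext0]) p.2
      change fderiv ℂ (ext0 (f * g).1) p e
        = f.1 p * fderiv ℂ (ext0 g.1) p e + g.1 p * fderiv ℂ (ext0 f.1) p e
      rw [h.fderiv_eq, fderiv_mul (ext0_differentiableAt f p) (ext0_differentiableAt g p)]
      simp [ext0])

/-! ### The Weierstrass functions attached to the curve `y² = x³ + λ₄ x + λ₆` -/

/-- The Weierstrass zeta function of the lattice of `L`. -/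
def zetaL (L : PeriodPair) (z : ℂ) : ℂ :=
  1 / z + ∑' l : L.lattice, if (l : ℂ) = 0 then 0 else (1 / (z - l) + 1 / l + z / (l : ℂ) ^ 2)

instance : Nonempty PeriodPair := by
  refine ⟨⟨1, Complex.I, ?_⟩⟩
  rw [LinearIndependent.pair_iff]
  intro s t h
  have h1 := congrArg Complex.re h
  have h2 := congrArg Complex.im h
  simp at h1 h2
  exact ⟨h1, h2⟩

/-- The curve `y² = x³ + λ₄ x + λ₆` is uniformized by the lattice of `L`: in the form
`y² = 4x³ - g₂ x - g₃` its coefficients are `g₂ = -4λ₄` and `g₃ = -4λ₆`. -/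
def IsPeriodPairOf (L : PeriodPair) (l4 l6 : ℂ) : Prop :=
  L.g₂ = -4 * l4 ∧ L.g₃ = -4 * l6

/-- A pair of generators of the period lattice of the curve `y² = x³ + λ₄ x + λ₆`. Only the lattice
they span, which is determined by the curve, matters below. -/
def periods (l4 l6 : ℂ) : PeriodPair :=
  Classical.epsilon fun L => IsPeriodPairOf L l4 l6

/-- The parameters of the nonsingular curves. -/
def IsNonsingular (l4 l6 : ℂ) : Prop := 4 * l4 ^ 3 + 27 * l6 ^ 2 ≠ 0

/-- The points `(u, λ)` with `λ` nonsingular and `u` outside the period lattice of `λ`. -/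
def regSet : Set E := {p | IsNonsingular p.2.1 p.2.2 ∧ p.1 ∉ (periods p.2.1 p.2.2).lattice}

/-- The function `℘(u; λ)`. -/
def wpFun (p : E) : ℂ := (periods p.2.1 p.2.2).weierstrassP p.1

/-- The function `ζ(u; λ)`. -/
def zetaFun (p : E) : ℂ := zetaL (periods p.2.1 p.2.2) p.1

/-- `regSet` as an open set. (`regSet` is open, so that it is its own interior.) -/
def X : Opens E := ⟨interior regSet, isOpen_interior⟩

/-- The algebra of holomorphic functions of `(u, λ)` on `X`. -/
abbrev O : Type := Holo X

open Classical in
/-- The restriction to `X` of a function that is holomorphic there (and `0` for other functions). -/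
def restr (F : E → ℂ) : O :=
  if h : AnalyticOnNhd ℂ F X then ⟨fun p => F p, F, h, fun _ => rfl⟩ else 0

/-- The functions `u`, `λ₄`, `λ₆`, `℘` and `ζ` on `X`, and the discriminant. -/
def u : O := restr fun p => p.1
def lam4 : O := restr fun p => p.2.1
def lam6 : O := restr fun p => p.2.2
def wp : O := restr wpFun
def zeta : O := restr zetaFun
def disc : O := 4 * lam4 ^ 3 + 27 * lam6 ^ 2

/-! ### The operators, the ring `𝒫₁` and the Lie algebra `ℒ₁` -/

/-- The partial derivatives in `u`, `λ₄` and `λ₆`. -/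
def du : Derivation ℂ O O := partialD X (1, 0, 0)
def d4 : Derivation ℂ O O := partialD X (0, 1, 0)
def d6 : Derivation ℂ O O := partialD X (0, 0, 1)

def ell0 : Derivation ℂ O O := (4 * lam4) • d4 + (6 * lam6) • d6
def ell2 : Derivation ℂ O O := (6 * lam6) • d4 - ((4 / 3 : ℂ) • lam4 ^ 2) • d6

def L0 : Derivation ℂ O O := ell0 - u • du
def L1 : Derivation ℂ O O := du
def L2 : Derivation ℂ O O := ell2 - zeta • du

/-- The ring generated over `ℂ` by `℘` and all its `u`-derivatives. -/
def P1 : Subalgebra ℂ O := Algebra.adjoin ℂ (Set.range fun i : ℕ => (du^[i]) wp)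

/-- The first-order differential operators `a ∂_u + b ∂_{λ₄} + c ∂_{λ₆}` that map `𝒫₁` to itself,
as a module over `𝒫₁`. -/
def derP1 : Submodule P1 (Derivation ℂ O O) where
  carrier := {D | (∃ a b c : O, D = a • du + b • d4 + c • d6) ∧ ∀ f ∈ P1, D f ∈ P1}
  add_mem' := by
    rintro D D' ⟨⟨a, b, c, h⟩, hD⟩ ⟨⟨a', b', c', h'⟩, hD'⟩
    refine ⟨⟨a + a', b + b', c + c', ?_⟩, fun f hf => add_mem (hD f hf) (hD' f hf)⟩
    rw [h, h']
    module
  zero_mem' := ⟨⟨0, 0, 0, by simp⟩, fun _ _ => zero_mem P1⟩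
  smul_mem' := by
    rintro q D ⟨⟨a, b, c, h⟩, hD⟩
    refine ⟨⟨q * a, q * b, q * c, ?_⟩, fun f hf => mul_mem q.2 (hD f hf)⟩
    rw [h]
    ext1 f
    change (q : O) * (a * du f + b * d4 f + c * d6 f) =
      (q : O) * a * du f + (q : O) * b * d4 f + (q : O) * c * d6 f
    ring

/-- `ℒ₁`: the operators in `derP1` that are tangent to the discriminant, i.e. that map the
discriminant into the ideal of `𝒫₁` generated by it. -/
def lieP1 : Submodule P1 (Derivation ℂ O O) where
  carrier := {D | D ∈ derP1 ∧ ∃ g ∈ P1, D disc = g * disc}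
  add_mem' := by
    rintro D D' ⟨h, g, hg, e⟩ ⟨h', g', hg', e'⟩
    exact ⟨add_mem h h', g + g', add_mem hg hg', by rw [Derivation.add_apply, e, e', add_mul]⟩
  zero_mem' := ⟨zero_mem _, 0, zero_mem _, by simp⟩
  smul_mem' := by
    rintro q D ⟨h, g, hg, e⟩
    refine ⟨derP1.smul_mem q h, q * g, mul_mem q.2 hg, ?_⟩
    change (q : O) * D disc = _
    rw [e, mul_assoc]

end

end EllipticDer

namespace EllipticDer
open Filter Topology PeriodPair

/-! ### The Weierstrass functions of a single lattice -/

section Lattice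

variable (L : PeriodPair)

/-! The algebra comes from two relations on each curve: `℘'² = 4℘³ + 4λ₄℘ + 4λ₆` and `℘'' = 6℘² +
2λ₄`. They show that `P1` is generated by `℘`, `℘'`, `λ₄`, contains `λ₆`, and is preserved by an
operator as soon as the three generators are sent into it.

Action on `℘`. Applying `L0` or `L2` to the curve equation shows that the discrepancy `h` between
the operator's value on `℘` and the claimed value solves `h' ℘' = ℘'' h`. So on each curve `h` is a
constant times `℘'`. Since `℘'` has a triple pole at `0` and `h` a milder one, `h = 0`
(`eq_zero_of_du_mul_eq`). The bracket of `L0` and `L2` agrees with `2 L2` up to a multiple of `∂`;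
evaluating on `℘` shows that this multiple vanishes (`L0_zeta`).

Module structure. The `λ`-coefficients of an operator in `derP1` are its values on `λ₄` and `λ₆`,
hence lie in `P1`. If it maps `Δ` to `gΔ`, subtracting `(g/12) L0` leaves an operator killing `Δ`;
as `λ₄` and `λ₆` have no common zero, its `λ`-part is a multiple of that of `L2`
(`exists_of_disc_eq_zero`). Without tangency, Cramer's rule does the same after multiplication by
`Δ`. What remains is `γ∂` with `γ℘'` in `P1`, and then `γ` is in `P1` (`mem_P1_of_mul_du_wp`),
because a polynomial in `℘` and `λ₄` that vanishes wherever `℘'` does is zero.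

Analysis. A lattice exists for every nonsingular curve because `aE₄³ - bE₆²` with `a ≠ b` has a zero
in the upper half plane (`exists_E4E6Form_eq_zero`). The periods are chosen with no regularity in
`λ`, so holomorphy is proved through the invariants: `u²℘` and `uζ` are universal power series in
`g₂u⁴` and `g₃u⁶`, convergent near the origin, and the duplication formulas carry holomorphy from
`u/2` to `u` (`goodAt_of_mem_regSet`). -/

theorem countable_lattice : (L.lattice : Set ℂ).Countable :=
  countable_of_Lindelof_of_discrete (X := L.lattice)

theorem isOpen_compl_lattice : IsOpen (L.lattice : Set ℂ)ᶜ := L.isClosed_lattice.isOpen_compl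

theorem isPreconnected_compl_lattice : IsPreconnected (L.lattice : Set ℂ)ᶜ :=
  ((countable_lattice L).isConnected_compl_of_one_lt_rank (by simp)).isPreconnected

/-- The points that are not half-periods. -/
def halfCompl : Set ℂ := {z | 2 * z ∉ L.lattice}

theorem isOpen_halfCompl : IsOpen (halfCompl L) :=
  (isOpen_compl_lattice L).preimage (continuous_const_mul (2 : ℂ))

theorem isPreconnected_halfCompl : IsPreconnected (halfCompl L) := by
  have h : ((fun z : ℂ => 2 * z) ⁻¹' (L.lattice : Set ℂ)).Countable :=
    (countable_lattice L).preimage (mul_right_injective₀ two_ne_zero)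
  exact (h.isConnected_compl_of_one_lt_rank (by simp)).isPreconnected

theorem notMem_of_mem_halfCompl {z : ℂ} (hz : z ∈ halfCompl L) : z ∉ L.lattice := fun h =>
  hz (by simpa [two_mul] using add_mem h h)

theorem eventually_notMem_lattice : ∀ᶠ z in 𝓝[≠] (0 : ℂ), z ∉ L.lattice := by
  filter_upwards [self_mem_nhdsWithin, mem_nhdsWithin_of_mem_nhds
    (L.compl_lattice_sdiff_singleton_mem_nhds 0)] with w hw hw' h
  exact hw' ⟨h, hw⟩

theorem tendsto_const_mul_nhdsNE {c : ℂ} (hc : c ≠ 0) :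
    Tendsto (fun z : ℂ => c * z) (𝓝[≠] 0) (𝓝[≠] 0) := by
  refine tendsto_nhdsWithin_iff.2 ⟨?_, ?_⟩
  · have : Tendsto (fun z : ℂ => c * z) (𝓝 0) (𝓝 (c * 0)) := (continuous_const_mul c).tendsto 0
    rw [mul_zero] at this
    exact this.mono_left nhdsWithin_le_nhds
  · filter_upwards [self_mem_nhdsWithin] with z hz
    exact mul_ne_zero hc hz

theorem eventually_mem_halfCompl : ∀ᶠ z in 𝓝[≠] (0 : ℂ), z ∈ halfCompl L :=
  (tendsto_const_mul_nhdsNE two_ne_zero).eventually (eventually_notMem_lattice L)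

theorem weierstrassP_eq (z : ℂ) : ℘[L] z = 1 / z ^ 2 + ℘[L - (0 : ℂ)] z := by
  have := L.weierstrassPExcept_add 0 z
  simp at this
  rw [← this]
  simp [add_comm]

theorem derivWeierstrassP_eq (z : ℂ) : ℘'[L] z = -2 / z ^ 3 + ℘'[L - (0 : ℂ)] z := by
  have := L.derivWeierstrassPExcept_sub 0 z
  simp at this
  rw [← this]
  ring

theorem tendsto_sq_mul_weierstrassP :
    Tendsto (fun z => z ^ 2 * ℘[L] z) (𝓝[≠] 0) (𝓝 1) := by
  have h : ContinuousAt (fun z => 1 + z ^ 2 * ℘[L - (0 : ℂ)] z) 0 := by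
    have := (L.analyticAt_weierstrassPExcept 0).continuousAt
    fun_prop
  have h1 := h.tendsto.mono_left (nhdsWithin_le_nhds (s := {0}ᶜ))
  simp only [ne_eq, OfNat.ofNat_ne_zero, not_false_eq_true, zero_pow, zero_mul, add_zero] at h1
  refine h1.congr' ?_
  filter_upwards [self_mem_nhdsWithin] with z hz
  have hz : z ≠ 0 := hz
  rw [weierstrassP_eq]
  field_simp

theorem tendsto_cube_mul_derivWeierstrassP :
    Tendsto (fun z => z ^ 3 * ℘'[L] z) (𝓝[≠] 0) (𝓝 (-2)) := by
  have h : ContinuousAt (fun z => -2 + z ^ 3 * ℘'[L - (0 : ℂ)] z) 0 := by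
    have := (L.analyticAt_derivWeierstrassPExcept 0).continuousAt
    fun_prop
  have h1 := h.tendsto.mono_left (nhdsWithin_le_nhds (s := {0}ᶜ))
  simp only [ne_eq, OfNat.ofNat_ne_zero, not_false_eq_true, zero_pow, zero_mul, add_zero] at h1
  refine h1.congr' ?_
  filter_upwards [self_mem_nhdsWithin] with z hz
  have hz : z ≠ 0 := hz
  rw [derivWeierstrassP_eq]
  field_simp

theorem hasDerivAt_weierstrassP {z : ℂ} (hz : z ∉ L.lattice) :
    HasDerivAt ℘[L] (℘'[L] z) z := by
  rw [← L.deriv_weierstrassP]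
  exact (L.analyticOnNhd_weierstrassP z hz).differentiableAt.hasDerivAt

theorem eventually_derivWeierstrassP_ne_zero : ∀ᶠ z in 𝓝[≠] (0 : ℂ), ℘'[L] z ≠ 0 := by
  filter_upwards [(tendsto_cube_mul_derivWeierstrassP L).eventually_ne
    (by norm_num : (-2 : ℂ) ≠ 0)] with z hz h
  simp [h] at hz

/-- `℘'' = 6 ℘² - g₂ / 2`. -/
theorem hasDerivAt_derivWeierstrassP {z : ℂ} (hz : z ∉ L.lattice) :
    HasDerivAt ℘'[L] (6 * ℘[L] z ^ 2 - L.g₂ / 2) z := by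
  have hd : ∀ w ∉ L.lattice, HasDerivAt ℘'[L] (deriv ℘'[L] w) w := fun w hw =>
    (L.analyticOnNhd_derivWeierstrassP w hw).differentiableAt.hasDerivAt
  -- Differentiating `℘'² = 4℘³ - g₂℘ - g₃` gives the claim multiplied by `℘'`. On a connected
  -- domain one factor must vanish identically, and it is not `℘'`.
  have key : ∀ w ∈ (L.lattice : Set ℂ)ᶜ,
      ℘'[L] w * (2 * deriv ℘'[L] w - 12 * ℘[L] w ^ 2 + L.g₂) = 0 := by
    intro w hw
    have h1 := (hd w hw).pow 2
    have h2 := (((hasDerivAt_weierstrassP L hw).pow 3).const_mul 4).sub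
      ((hasDerivAt_weierstrassP L hw).const_mul L.g₂) |>.sub_const L.g₃
    have h3 := h1.unique (h2.congr_of_eventuallyEq ?_)
    · push_cast at h3
      linear_combination h3
    · filter_upwards [(isOpen_compl_lattice L).mem_nhds hw] with x hx
      exact L.derivWeierstrassP_sq x hx
  have ha := L.analyticOnNhd_derivWeierstrassP
  have hb : AnalyticOnNhd ℂ (fun w => 2 * deriv ℘'[L] w - 12 * ℘[L] w ^ 2 + L.g₂)
      (L.lattice : Set ℂ)ᶜ := by
    intro w hw
    have h1 := ha.deriv w hw
    have h2 := L.analyticOnNhd_weierstrassP w hw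
    fun_prop
  rcases ha.eq_zero_or_eq_zero_of_mul_eq_zero hb key (isPreconnected_compl_lattice L) with h | h
  · obtain ⟨w, h1, h2⟩ := ((eventually_derivWeierstrassP_ne_zero L).and
      (eventually_notMem_lattice L)).exists
    exact (h1 (h w h2)).elim
  · have := hd z hz
    have e := h z hz
    rwa [show deriv ℘'[L] z = 6 * ℘[L] z ^ 2 - L.g₂ / 2 by
      linear_combination e / 2] at this

/-- Periodicity and oddness of `℘'`. Read backwards, `℘'(u/2) ≠ 0` certifies that `u` is not a
period; this is how `regSet` is shown to be open. -/
theorem derivWeierstrassP_eq_zero_of_two_mul_mem {z : ℂ} (hz : 2 * z ∈ L.lattice) :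
    ℘'[L] z = 0 := by
  have h := L.derivWeierstrassP_sub_coe z ⟨2 * z, hz⟩
  rw [show z - 2 * z = -z by ring, derivWeierstrassP_neg] at h
  exact CharZero.neg_eq_self_iff.1 h

/-- A function on a punctured neighbourhood of `0` that is meromorphic, even, and behaves
like a solution of `z f' = -3 f` vanishes. -/
theorem eventually_eq_zero_of_even_of_mul_deriv {f β : ℂ → ℂ} (hf : MeromorphicAt f 0)
    (heven : ∀ᶠ z in 𝓝[≠] (0 : ℂ), f (-z) = f z) (hβ : Tendsto β (𝓝[≠] 0) (𝓝 (-3)))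
    (hode : ∀ᶠ z in 𝓝[≠] (0 : ℂ), z * deriv f z = β z * f z) :
    ∀ᶠ z in 𝓝[≠] (0 : ℂ), f z = 0 := by
  by_contra hne
  have htop : meromorphicOrderAt f 0 ≠ ⊤ := fun h => hne (meromorphicOrderAt_eq_top_iff.1 h)
  obtain ⟨n, hn⟩ := WithTop.ne_top_iff_exists.1 htop
  obtain ⟨g, hg, hg0, hfg⟩ := (meromorphicOrderAt_eq_int_iff hf).1 hn.symm
  simp only [sub_zero, smul_eq_mul] at hfg
  have hlim : Tendsto g (𝓝[≠] 0) (𝓝 (g 0)) := hg.continuousAt.tendsto.mono_left nhdsWithin_le_nhds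
  have hneg : Tendsto (fun z : ℂ => -z) (𝓝[≠] 0) (𝓝[≠] 0) := by
    simpa using tendsto_const_mul_nhdsNE (c := -1) (by norm_num)
  -- Evenness constrains the order `n` of `f`: comparing leading coefficients at `z` and `-z` rules
  -- out odd `n`.
  have hpar : g 0 = (-1) ^ n * g 0 := by
    refine tendsto_nhds_unique hlim (((hlim.comp hneg).const_mul ((-1 : ℂ) ^ n)).congr' ?_)
    filter_upwards [hfg, hneg.eventually hfg, heven, self_mem_nhdsWithin] with z h1 h2 h3 hz
    have hz : z ≠ 0 := hz
    rw [h1, h2, neg_eq_neg_one_mul z, mul_zpow] at h3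
    refine mul_left_cancel₀ (zpow_ne_zero n hz) ?_
    simp only [Function.comp]
    rw [← h3, neg_eq_neg_one_mul z]
    ring
  -- The leading coefficient in `z f' = β f` forces `n = -3`, which is odd.
  have hord : (n : ℂ) * g 0 = -3 * g 0 := by
    have h1 : Tendsto (fun z => n * g z + z * deriv g z) (𝓝[≠] 0)
        (𝓝 (n * g 0 + 0 * deriv g 0)) := by
      refine (hlim.const_mul _).add (Tendsto.mul ?_ ?_)
      · exact tendsto_id.mono_left nhdsWithin_le_nhds
      · exact hg.deriv.continuousAt.tendsto.mono_left nhdsWithin_le_nhds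
    rw [zero_mul, add_zero] at h1
    refine tendsto_nhds_unique h1 ((hβ.mul hlim).congr' ?_)
    filter_upwards [hfg, hode, self_mem_nhdsWithin, eventually_eventually_nhdsWithin.2 hfg,
      hg.eventually_analyticAt.filter_mono nhdsWithin_le_nhds] with z h1 h2 hz h4 h5
    have hz : z ≠ 0 := hz
    rw [(isOpen_compl_singleton.nhdsWithin_eq hz)] at h4
    have h6 : HasDerivAt f (n * z ^ (n - 1) * g z + z ^ n * deriv g z) z :=
      ((hasDerivAt_zpow n z (Or.inl hz)).mul h5.differentiableAt.hasDerivAt).congr_of_eventuallyEq h4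
    rw [h6.deriv, h1] at h2
    refine mul_left_cancel₀ (zpow_ne_zero n hz) ?_
    have : z ^ n = z * z ^ (n - 1) := by rw [← zpow_one_add₀ hz]; congr 1; ring
    rw [this] at h2 ⊢
    linear_combination -h2
  have hn3 : n = -3 := by
    have := mul_right_cancel₀ hg0 hord
    exact_mod_cast this
  rw [hn3] at hpar
  have : g 0 = -g 0 := by
    rw [show ((-1 : ℂ) ^ (-3 : ℤ)) = -1 by norm_num] at hpar
    linear_combination hpar
  exact hg0 (CharZero.eq_neg_self_iff.1 this)

end Lattice
end EllipticDer

namespace EllipticDer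
open Filter Topology PeriodPair

/-! ### Duplication formula for `℘` and surjectivity onto the curve -/

section Duplication

variable (L : PeriodPair)

/-- The right-hand side of the duplication formula for `℘`. -/
noncomputable def dupP (z : ℂ) : ℂ :=
  (6 * ℘[L] z ^ 2 - L.g₂ / 2) ^ 2 / (4 * ℘'[L] z ^ 2) - 2 * ℘[L] z

/-- The derivative of `dupP`. -/
noncomputable def dupP' (z : ℂ) : ℂ :=
  6 * ℘[L] z * (6 * ℘[L] z ^ 2 - L.g₂ / 2) / ℘'[L] z
    - (6 * ℘[L] z ^ 2 - L.g₂ / 2) ^ 3 / (2 * ℘'[L] z ^ 3) - 2 * ℘'[L] z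

theorem hasDerivAt_dupP {z : ℂ} (hz : z ∉ L.lattice) (h0 : ℘'[L] z ≠ 0) :
    HasDerivAt (dupP L) (dupP' L z) z := by
  have hP := hasDerivAt_weierstrassP L hz
  have hP' := hasDerivAt_derivWeierstrassP L hz
  have h := ((((hP.pow 2).const_mul 6).sub_const (L.g₂ / 2)).pow 2).div ((hP'.pow 2).const_mul 4)
    (mul_ne_zero (by norm_num) (pow_ne_zero 2 h0)) |>.sub (hP.const_mul 2)
  refine h.congr_deriv ?_
  simp only [dupP', Pi.pow_apply]
  push_cast
  field_simp
  ring

/-- This is the fact that doubling a point stays on the curve. It makes `dupP` satisfy the same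
first-order differential equation as `z ↦ ℘(2z)`. -/
theorem dupP'_sq {z : ℂ} (hz : z ∉ L.lattice) (h0 : ℘'[L] z ≠ 0) :
    dupP' L z ^ 2 = 4 * (4 * dupP L z ^ 3 - L.g₂ * dupP L z - L.g₃) := by
  have hsq := L.derivWeierstrassP_sq z hz
  set x := ℘[L] z
  set y := ℘'[L] z
  have h1 : dupP' L z * y ^ 3 = 6 * x * (6 * x ^ 2 - L.g₂ / 2) * y ^ 2
      - (6 * x ^ 2 - L.g₂ / 2) ^ 3 / 2 - 2 * (y ^ 2) ^ 2 := by
    change (6 * x * (6 * x ^ 2 - L.g₂ / 2) / y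
      - (6 * x ^ 2 - L.g₂ / 2) ^ 3 / (2 * y ^ 3) - 2 * y) * y ^ 3 = _
    field_simp
  have h2 : dupP L z * y ^ 2 = (6 * x ^ 2 - L.g₂ / 2) ^ 2 / 4 - 2 * x * y ^ 2 := by
    change ((6 * x ^ 2 - L.g₂ / 2) ^ 2 / (4 * y ^ 2) - 2 * x) * y ^ 2 = _
    field_simp
  refine mul_right_cancel₀ (pow_ne_zero 6 h0) ?_
  have e1 : dupP' L z ^ 2 * y ^ 6 = (dupP' L z * y ^ 3) ^ 2 := by ring
  have e2 : 4 * (4 * dupP L z ^ 3 - L.g₂ * dupP L z - L.g₃) * y ^ 6 =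
      4 * (4 * (dupP L z * y ^ 2) ^ 3 - L.g₂ * (dupP L z * y ^ 2) * (y ^ 2) ^ 2
        - L.g₃ * (y ^ 2) ^ 3) := by ring
  rw [e1, e2, h1, h2, hsq]
  ring

theorem tendsto_sq_mul_dupP : Tendsto (fun z => z ^ 2 * dupP L z) (𝓝[≠] 0) (𝓝 (1 / 4)) := by
  have hid : Tendsto (fun z : ℂ => z) (𝓝[≠] 0) (𝓝 0) := tendsto_id.mono_left nhdsWithin_le_nhds
  have h := ((((tendsto_sq_mul_weierstrassP L).pow 2).const_mul 6).sub
    ((hid.pow 4).mul_const (L.g₂ / 2)) |>.pow 2).div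
    (((tendsto_cube_mul_derivWeierstrassP L).pow 2).const_mul 4) (by norm_num) |>.sub
    ((tendsto_sq_mul_weierstrassP L).const_mul 2)
  refine (h.congr' ?_).trans_eq (by norm_num)
  filter_upwards [self_mem_nhdsWithin, eventually_derivWeierstrassP_ne_zero L] with z hz h0
  have hz : z ≠ 0 := hz
  simp only [dupP, Pi.div_apply]
  field_simp

theorem tendsto_cube_mul_dupP' : Tendsto (fun z => z ^ 3 * dupP' L z) (𝓝[≠] 0) (𝓝 (-1 / 2)) := by
  have hid : Tendsto (fun z : ℂ => z) (𝓝[≠] 0) (𝓝 0) := tendsto_id.mono_left nhdsWithin_le_nhds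
  have hP := tendsto_sq_mul_weierstrassP L
  have hA := ((hP.pow 2).const_mul 6).sub ((hid.pow 4).mul_const (L.g₂ / 2))
  have hP' := tendsto_cube_mul_derivWeierstrassP L
  have h := (((hP.const_mul 6).mul hA).div hP' (by norm_num)).sub
    ((hA.pow 3).div ((hP'.pow 3).const_mul 2) (by norm_num)) |>.sub (hP'.const_mul 2)
  refine (h.congr' ?_).trans_eq (by norm_num)
  filter_upwards [self_mem_nhdsWithin, eventually_derivWeierstrassP_ne_zero L] with z hz h0
  have hz : z ≠ 0 := hz
  simp only [dupP', Pi.div_apply]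
  field_simp

/-- Both functions are even, solve the same equation and have the same leading terms at `0`.
Subtracting the two equations and dividing by the sum of the derivatives gives a linear equation `z
f' = β f` for the difference. -/
theorem eventually_dupP_eq : ∀ᶠ z in 𝓝[≠] (0 : ℂ), dupP L z - ℘[L] (2 * z) = 0 := by
  have h2 := tendsto_const_mul_nhdsNE (two_ne_zero (α := ℂ))
  have hq : Tendsto (fun z => z ^ 2 * ℘[L] (2 * z)) (𝓝[≠] 0) (𝓝 (1 / 4)) := by
    refine ((((tendsto_sq_mul_weierstrassP L).comp h2).const_mul (1 / 4)).congr fun z => ?_).trans_eq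
      (by norm_num)
    simp only [Function.comp]
    ring
  have hq' : Tendsto (fun z => z ^ 3 * (2 * ℘'[L] (2 * z))) (𝓝[≠] 0) (𝓝 (-1 / 2)) := by
    refine ((((tendsto_cube_mul_derivWeierstrassP L).comp h2).const_mul (1 / 4)).congr
      fun z => ?_).trans_eq (by norm_num)
    simp only [Function.comp]
    ring
  have hid : Tendsto (fun z : ℂ => z) (𝓝[≠] 0) (𝓝 0) := tendsto_id.mono_left nhdsWithin_le_nhds
  have hw := tendsto_sq_mul_dupP L
  have hden := (tendsto_cube_mul_dupP' L).add hq'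
  refine eventually_eq_zero_of_even_of_mul_deriv
    -- With `w`, `q` the two functions, `w'² - q'² = 4(4(w² + wq + q²) - g₂)(w - q)`. Powers of `z`
    -- are inserted so that every factor has a limit: `w, q ~ 1/(4z²)` and `w', q' ~ -1/(2z³)`, so
    -- `β → 16·(3/16)/(-1) = -3`.
    (β := fun z => (16 * ((z ^ 2 * dupP L z) ^ 2 + (z ^ 2 * dupP L z) * (z ^ 2 * ℘[L] (2 * z))
      + (z ^ 2 * ℘[L] (2 * z)) ^ 2) - z ^ 4 * (4 * L.g₂)) /
      (z ^ 3 * dupP' L z + z ^ 3 * (2 * ℘'[L] (2 * z)))) ?_ ?_ ?_ ?_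
  · have h1 := L.meromorphic_weierstrassP 0
    have h2 := L.meromorphic_derivWeierstrassP 0
    have h3 : MeromorphicAt (fun z : ℂ => ℘[L] (2 * z)) 0 := by
      have := L.meromorphic_weierstrassP ((2 : ℂ) * 0)
      exact this.comp_analyticAt (g := fun z : ℂ => 2 * z) (by fun_prop)
    unfold dupP
    fun_prop
  · refine Eventually.of_forall fun z => ?_
    simp only [dupP, derivWeierstrassP_neg, weierstrassP_neg, mul_neg]
    ring
  · have := ((((hw.pow 2).add (hw.mul hq)).add (hq.pow 2)).const_mul 16).sub
      ((hid.pow 4).mul_const (4 * L.g₂)) |>.div hden (by norm_num)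
    exact this.trans_eq (by norm_num)
  · filter_upwards [self_mem_nhdsWithin, eventually_derivWeierstrassP_ne_zero L,
      eventually_mem_halfCompl L, hden.eventually_ne
        (by norm_num : (-1 / 2 + -1 / 2 : ℂ) ≠ 0)] with z hz h0 hh hne
    have hz : z ≠ 0 := hz
    have hd := (hasDerivAt_dupP L (notMem_of_mem_halfCompl L hh) h0).sub
      ((hasDerivAt_weierstrassP L hh).comp z ((hasDerivAt_id z).const_mul 2))
    have hd' : deriv (fun z => dupP L z - ℘[L] (2 * z)) z = dupP' L z - 2 * ℘'[L] (2 * z) := by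
      refine HasDerivAt.deriv (hd.congr_deriv ?_)
      ring
    have e1 := dupP'_sq L (notMem_of_mem_halfCompl L hh) h0
    have e2 := L.derivWeierstrassP_sq (2 * z) hh
    rw [hd', div_mul_eq_mul_div, eq_div_iff hne]
    linear_combination z ^ 4 * e1 - 4 * z ^ 4 * e2

/-- An identity between analytic functions on the complement of the half-periods that holds near
`0` holds everywhere. -/
theorem eqOn_halfCompl_of_eventually {f g : ℂ → ℂ} (hf : AnalyticOnNhd ℂ f (halfCompl L))
    (hg : AnalyticOnNhd ℂ g (halfCompl L)) (h : ∀ᶠ z in 𝓝[≠] (0 : ℂ), f z = g z) :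
    Set.EqOn f g (halfCompl L) := by
  obtain ⟨z, h1, h2, hz⟩ := ((eventually_eventually_nhdsWithin.2 h).and
    ((eventually_mem_halfCompl L).and self_mem_nhdsWithin)).exists
  rw [isOpen_compl_singleton.nhdsWithin_eq hz] at h1
  exact hf.eqOn_of_preconnected_of_eventuallyEq hg (isPreconnected_halfCompl L) h2 h1

/-- The denominators are cleared because `℘'` is not yet known to be nonzero away from the
half-periods. This polynomial form is what yields that nonvanishing. -/
theorem four_mul_derivWeierstrassP_sq_mul {z : ℂ} (hz : z ∈ halfCompl L) :
    4 * ℘'[L] z ^ 2 * (℘[L] (2 * z) + 2 * ℘[L] z) = (6 * ℘[L] z ^ 2 - L.g₂ / 2) ^ 2 := by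
  have hP : AnalyticOnNhd ℂ ℘[L] (halfCompl L) := fun w hw =>
    L.analyticOnNhd_weierstrassP w (notMem_of_mem_halfCompl L hw)
  have hP' : AnalyticOnNhd ℂ ℘'[L] (halfCompl L) := fun w hw =>
    L.analyticOnNhd_derivWeierstrassP w (notMem_of_mem_halfCompl L hw)
  have hP2 : AnalyticOnNhd ℂ (fun w : ℂ => ℘[L] (2 * w)) (halfCompl L) := fun w hw =>
    (L.analyticOnNhd_weierstrassP (2 * w) hw).comp (f := fun w : ℂ => 2 * w) (by fun_prop)
  refine eqOn_halfCompl_of_eventually L (f := fun z => 4 * ℘'[L] z ^ 2 * (℘[L] (2 * z) + 2 * ℘[L] z))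
    (g := fun z => (6 * ℘[L] z ^ 2 - L.g₂ / 2) ^ 2) ?_ ?_ ?_ hz
  · intro w hw
    have := hP w hw
    have := hP' w hw
    have := hP2 w hw
    fun_prop
  · intro w hw
    have := hP w hw
    fun_prop
  · filter_upwards [eventually_dupP_eq L, eventually_derivWeierstrassP_ne_zero L] with z h1 h2
    rw [← sub_eq_zero.1 h1, dupP]
    field_simp
    ring

/-- The polynomial `4 x³ - g₂ x - g₃` has no multiple root. -/
def IsRegular : Prop := L.g₂ ^ 3 - 27 * L.g₃ ^ 2 ≠ 0

variable {L}

theorem secondDeriv_ne_zero (hL : IsRegular L) {x : ℂ} (hx : 4 * x ^ 3 - L.g₂ * x - L.g₃ = 0) :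
    6 * x ^ 2 - L.g₂ / 2 ≠ 0 := by
  intro h
  apply hL
  have h2 : L.g₂ = 12 * x ^ 2 := by linear_combination -2 * h
  have h3 : L.g₃ = -8 * x ^ 3 := by rw [h2] at hx; linear_combination -hx
  rw [h2, h3]
  ring

/-- At a zero of `℘'` the cleared duplication formula forces `6℘² - g₂/2 = 0` too, so `℘(z)` would
be a multiple root of the cubic. -/
theorem derivWeierstrassP_ne_zero (hL : IsRegular L) {z : ℂ} (hz : z ∈ halfCompl L) :
    ℘'[L] z ≠ 0 := by
  intro h
  have h1 := four_mul_derivWeierstrassP_sq_mul L hz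
  have h2 := L.derivWeierstrassP_sq z (notMem_of_mem_halfCompl L hz)
  rw [h] at h1 h2
  refine secondDeriv_ne_zero hL (x := ℘[L] z) ?_ (pow_eq_zero_iff two_ne_zero |>.1 (a := _) ?_)
  · linear_combination -h2
  · rw [← h1]; ring

/-- The duplication formula for `℘`. -/
theorem weierstrassP_two_mul (hL : IsRegular L) {z : ℂ} (hz : z ∈ halfCompl L) :
    ℘[L] (2 * z) = dupP L z := by
  have h1 := four_mul_derivWeierstrassP_sq_mul L hz
  have h0 := derivWeierstrassP_ne_zero hL hz
  rw [dupP, eq_sub_iff_add_eq, eq_div_iff (mul_ne_zero (by norm_num) (pow_ne_zero 2 h0)), ← h1]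
  ring

/-- `(℘, ℘')` takes all values on the curve. -/
theorem exists_weierstrassP_eq (x y : ℂ) (h : y ^ 2 = 4 * x ^ 3 - L.g₂ * x - L.g₃) :
    ∃ z ∉ L.lattice, ℘[L] z = x ∧ ℘'[L] z = y := by
  obtain ⟨z, hz, hzx⟩ : ∃ z ∉ L.lattice, ℘[L] z = x := by
    by_contra! hne
    classical
    -- If `℘` omitted the value `x`, then `1/(℘ - x)`, filled in by `0` at the poles of `℘`, would
    -- be entire and periodic, hence constant by Liouville and equal to its value `0` at the origin.
    let f : ℂ → ℂ := fun z => if z ∈ L.lattice then 0 else (℘[L] z - x)⁻¹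
    have hper : ∀ z w, w ∈ L.lattice → f (z + w) = f z := by
      intro z w hw
      have h1 : z + w ∈ L.lattice ↔ z ∈ L.lattice := L.lattice.add_mem_iff_left hw
      have h2 := L.weierstrassP_add_coe z ⟨w, hw⟩
      simp only [f, h1]
      simp only [] at h2
      rw [h2]
    have hev : ∀ᶠ z in 𝓝[≠] (0 : ℂ), f z = z ^ 2 / (z ^ 2 * ℘[L] z - z ^ 2 * x) := by
      filter_upwards [eventually_notMem_lattice L, self_mem_nhdsWithin] with z h1 hz
      have hz : z ≠ 0 := hz
      have := sub_ne_zero.2 (hne z h1)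
      simp only [f, h1, if_false]
      rw [← mul_sub]
      field_simp
    have hid : Tendsto (fun z : ℂ => z) (𝓝[≠] 0) (𝓝 0) := tendsto_id.mono_left nhdsWithin_le_nhds
    have hlim : Tendsto f (𝓝[≠] 0) (𝓝 0) := by
      have := (hid.pow 2).div ((tendsto_sq_mul_weierstrassP L).sub ((hid.pow 2).mul_const x))
        (by norm_num)
      refine (this.congr' ?_).trans_eq (by norm_num)
      filter_upwards [hev] with z hz
      exact hz.symm
    have hf0 : f 0 = 0 := by simp [f]
    have hd : ∀ z ∉ L.lattice, DifferentiableAt ℂ f z := by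
      intro z hz
      have h1 : DifferentiableAt ℂ (fun z => (℘[L] z - x)⁻¹) z :=
        ((hasDerivAt_weierstrassP L hz).differentiableAt.sub_const x).inv (sub_ne_zero.2 (hne z hz))
      refine h1.congr_of_eventuallyEq ?_
      filter_upwards [(isOpen_compl_lattice L).mem_nhds hz] with w hw
      exact if_neg hw
    have hd0 : DifferentiableAt ℂ f 0 := by
      refine (Complex.analyticAt_of_differentiable_on_punctured_nhds_of_continuousAt ?_ ?_
        ).differentiableAt
      · filter_upwards [eventually_notMem_lattice L] with z hz using hd z hz
      · rw [continuousAt_iff_punctured_nhds, hf0]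
        exact hlim
    have hD : Differentiable ℂ f := by
      intro z
      by_cases hz : z ∈ L.lattice
      · have : f = fun w => f (w - z) := by
          ext w
          have := hper (w - z) z hz
          rw [sub_add_cancel] at this
          exact this
        rw [this]
        have h2 : DifferentiableAt ℂ f (z - z) := by rw [sub_self]; exact hd0
        exact h2.comp z (f := fun w : ℂ => w - z) (by fun_prop)
      · exact hd z hz
    obtain ⟨w, hw⟩ := (eventually_notMem_lattice L).exists
    have := hD.apply_eq_apply_of_bounded
      (IsZLattice.isCompact_range_of_periodic L.lattice f hD.continuous hper).isBounded w 0
    rw [hf0] at this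
    simp only [f, hw, if_false, inv_eq_zero] at this
    exact sub_ne_zero.2 (hne w hw) this
  have h2 := L.derivWeierstrassP_sq z hz
  rw [hzx, ← h] at h2
  rcases sq_eq_sq_iff_eq_or_eq_neg.1 h2 with h3 | h3
  · exact ⟨z, hz, hzx, h3⟩
  · refine ⟨-z, by simpa using hz, by rw [weierstrassP_neg, hzx], ?_⟩
    rw [derivWeierstrassP_neg, h3, neg_neg]

end Duplication
end EllipticDer

namespace EllipticDer
open Filter Topology PeriodPair

/-! ### The Weierstrass zeta function and its duplication formula -/

section Zeta

variable (L : PeriodPair)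

/-- The Weierstrass zeta function without its pole at `0`. -/
noncomputable def zetaExcept (z : ℂ) : ℂ :=
  ∑' l : L.lattice, if (l : ℂ) = 0 then 0 else (1 / (z - l) + 1 / l + z / (l : ℂ) ^ 2)

theorem zetaL_eq (z : ℂ) : zetaL L z = 1 / z + zetaExcept L z := rfl

theorem zetaExcept_neg (z : ℂ) : zetaExcept L (-z) = -zetaExcept L z := by
  unfold zetaExcept
  rw [← (Equiv.neg L.lattice).tsum_eq, ← tsum_neg]
  congr 1 with l
  simp only [Equiv.neg_apply, NegMemClass.coe_neg, neg_eq_zero, even_two, Even.neg_pow]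
  split_ifs
  · simp
  · rw [show -z - -(l : ℂ) = -(z - l) by ring]
    simp only [div_neg, neg_div]
    ring

theorem zetaL_neg (z : ℂ) : zetaL L (-z) = -zetaL L z := by
  rw [zetaL_eq, zetaL_eq, zetaExcept_neg, div_neg]
  ring

/-- The summand equals `z²/((z - l) l²)`, and `|z - l| ≥ |l|/2` once `|l| ≥ 2r`, so the series is
dominated by the convergent sum of `|l|⁻³`. -/
theorem hasSumLocallyUniformly_zetaExcept :
    HasSumLocallyUniformly (fun (l : L.lattice) (z : ℂ) =>
      if (l : ℂ) = 0 then 0 else (1 / (z - l) + 1 / l + z / (l : ℂ) ^ 2)) (zetaExcept L) := by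
  refine L.hasSumLocallyUniformly_aux (u := fun r => (2 * r ^ 2 * ‖·‖ ^ (-3 : ℝ))) _
    (fun _ _ => (ZLattice.summable_norm_rpow _ _ (by simp; norm_num)).mul_left _) fun r hr =>
    Filter.eventually_atTop.mpr ⟨2 * r, ?_⟩
  rintro _ h s hs l rfl
  split_ifs with h0
  · rw [norm_zero]
    positivity
  · have hl : 0 < ‖(l : ℂ)‖ := norm_pos_iff.2 h0
    have hsl : s - l ≠ 0 := by
      intro e
      rw [sub_eq_zero.1 e] at hs
      linarith
    have e : 1 / (s - l) + 1 / l + s / (l : ℂ) ^ 2 = s ^ 2 / ((s - l) * (l : ℂ) ^ 2) := by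
      field_simp
      ring
    rw [e, norm_div, norm_pow, norm_mul, norm_pow]
    have h2 : ‖(l : ℂ)‖ / 2 ≤ ‖s - l‖ := by
      rw [norm_sub_rev]
      have := norm_sub_norm_le (l : ℂ) s
      linarith
    have h3 : (2 * r ^ 2 * ‖l‖ ^ (-3 : ℝ)) = r ^ 2 / (‖(l : ℂ)‖ / 2 * ‖(l : ℂ)‖ ^ 2) := by
      rw [← Submodule.coe_norm, Real.rpow_neg (norm_nonneg _)]
      norm_cast
      have : ‖l‖ ≠ 0 := hl.ne'
      field_simp
    rw [h3]
    gcongr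

theorem differentiableAt_zeta_summand {l z : ℂ} (h : l ≠ 0 → z ≠ l) :
    HasDerivAt (fun z => if l = 0 then 0 else (1 / (z - l) + 1 / l + z / l ^ 2))
      (-(if l = 0 then 0 else (1 / (z - l) ^ 2 - 1 / l ^ 2))) z := by
  split_ifs with h0
  · simpa using hasDerivAt_const z (0 : ℂ)
  · have h1 : z - l ≠ 0 := sub_ne_zero.2 (h h0)
    have := (((hasDerivAt_id z).sub_const l).fun_inv h1).add_const (1 / l) |>.add
      ((hasDerivAt_id z).div_const (l ^ 2))
    simp only [id, ← one_div] at this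
    refine this.congr_deriv ?_
    ring

theorem hasDerivAt_zetaExcept {z : ℂ} (hz : z ∈ ((L.lattice : Set ℂ) \ {0})ᶜ) :
    HasDerivAt (zetaExcept L) (-℘[L - (0 : ℂ)] z) z := by
  have hne : ∀ l : L.lattice, ∀ w ∈ ((L.lattice : Set ℂ) \ {0})ᶜ, (l : ℂ) ≠ 0 → w ≠ l := by
    rintro l w hw h0 rfl
    exact hw ⟨l.2, h0⟩
  have hs := (hasSumLocallyUniformly_zetaExcept L).tendstoLocallyUniformlyOn
    (s := ((L.lattice : Set ℂ) \ {0})ᶜ)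
  have hdiff : ∀ s : Finset L.lattice, ∀ w ∈ ((L.lattice : Set ℂ) \ {0})ᶜ, HasDerivAt (fun z =>
      ∑ l ∈ s, if (l : ℂ) = 0 then 0 else (1 / (z - l) + 1 / l + z / (l : ℂ) ^ 2))
      (∑ l ∈ s, -(if (l : ℂ) = 0 then 0 else (1 / (w - l) ^ 2 - 1 / (l : ℂ) ^ 2))) w :=
    fun s w hw => HasDerivAt.fun_sum fun l _ => differentiableAt_zeta_summand (hne l w hw)
  have hD : DifferentiableOn ℂ (zetaExcept L) ((L.lattice : Set ℂ) \ {0})ᶜ :=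
    hs.differentiableOn (.of_forall fun s w hw => (hdiff s w hw).differentiableAt.differentiableWithinAt)
      L.isOpen_compl_lattice_sdiff
  have hlim := (hs.deriv (.of_forall fun s w hw =>
    (hdiff s w hw).differentiableAt.differentiableWithinAt) L.isOpen_compl_lattice_sdiff
    ).tendsto_at hz
  have h2 : Tendsto (fun s : Finset L.lattice =>
      ∑ l ∈ s, -(if (l : ℂ) = 0 then 0 else (1 / (z - l) ^ 2 - 1 / (l : ℂ) ^ 2))) atTop
      (𝓝 (-℘[L - (0 : ℂ)] z)) := (L.hasSum_weierstrassPExcept 0 z).neg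
  have h3 : deriv (zetaExcept L) z = -℘[L - (0 : ℂ)] z := by
    refine tendsto_nhds_unique hlim (h2.congr fun s => ?_)
    exact (hdiff s z hz).deriv.symm
  rw [← h3]
  exact (hD.differentiableAt (L.isOpen_compl_lattice_sdiff.mem_nhds hz)).hasDerivAt

theorem zetaExcept_zero : zetaExcept L 0 = 0 := by
  have := zetaExcept_neg L 0
  rw [neg_zero] at this
  exact CharZero.eq_neg_self_iff.1 this

theorem analyticOnNhd_zetaExcept :
    AnalyticOnNhd ℂ (zetaExcept L) ((L.lattice : Set ℂ) \ {0})ᶜ :=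
  DifferentiableOn.analyticOnNhd (fun _ hz => (hasDerivAt_zetaExcept L hz).differentiableAt.differentiableWithinAt)
    L.isOpen_compl_lattice_sdiff

theorem hasDerivAt_zetaL {z : ℂ} (hz : z ∉ L.lattice) : HasDerivAt (zetaL L) (-℘[L] z) z := by
  have hz0 : z ≠ 0 := by rintro rfl; exact hz (zero_mem _)
  have h := ((hasDerivAt_id z).fun_inv hz0).add (hasDerivAt_zetaExcept L (fun h => hz h.1))
  simp only [id, ← one_div] at h
  refine (h.congr_deriv ?_)
  rw [weierstrassP_eq]
  ring

variable {L}

/-- The duplication formula for `ζ`. -/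
theorem zetaL_two_mul (hL : IsRegular L) {z : ℂ} (hz : z ∈ halfCompl L) :
    zetaL L (2 * z) = 2 * zetaL L z + (6 * ℘[L] z ^ 2 - L.g₂ / 2) / (2 * ℘'[L] z) := by
  -- The duplication formula for `℘` makes `D' = 0`, so `D` is constant on the connected complement
  -- of the half-periods; it is also odd, hence zero.
  set D : ℂ → ℂ := fun z =>
    zetaL L (2 * z) - 2 * zetaL L z - (6 * ℘[L] z ^ 2 - L.g₂ / 2) / (2 * ℘'[L] z) with hDdef
  have hD : ∀ w ∈ halfCompl L, HasDerivAt D 0 w := by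
    intro w hw
    have hw' := notMem_of_mem_halfCompl L hw
    have h0 := derivWeierstrassP_ne_zero hL hw
    have h1 := ((hasDerivAt_zetaL L hw).comp w ((hasDerivAt_id w).const_mul 2)).sub
      ((hasDerivAt_zetaL L hw').const_mul 2) |>.sub
      (((((hasDerivAt_weierstrassP L hw').pow 2).const_mul 6).sub_const (L.g₂ / 2)).div
        ((hasDerivAt_derivWeierstrassP L hw').const_mul 2) (mul_ne_zero two_ne_zero h0))
    refine h1.congr_deriv ?_
    rw [weierstrassP_two_mul hL hw, dupP]
    simp only [Pi.pow_apply]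
    push_cast
    field_simp
    ring
  have hneg : -z ∈ halfCompl L := by
    have : 2 * -z = -(2 * z) := by ring
    simpa [halfCompl, this] using hz
  have hc : D z = D (-z) := (isOpen_halfCompl L).is_const_of_deriv_eq_zero
    (isPreconnected_halfCompl L) (fun w hw => (hD w hw).differentiableAt.differentiableWithinAt)
    (fun w hw => (hD w hw).deriv) hz hneg
  have hodd : D (-z) = -D z := by
    simp only [hDdef, mul_neg, zetaL_neg, weierstrassP_neg, derivWeierstrassP_neg, div_neg]
    ring
  rw [hodd] at hc
  have := CharZero.eq_neg_self_iff.1 hc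
  linear_combination this

end Zeta
end EllipticDer

namespace EllipticDer
open Filter Topology

/-! ### Existence of the period lattice, via modular forms -/

section Existence

open UpperHalfPlane ModularForm SlashInvariantForm SlashInvariantFormClass ModularFormClass
  MatrixGroups OnePoint EisensteinSeries

theorem tendsto_E_atImInfty {k : ℕ} (hk : 3 ≤ k) (hk2 : Even k) :
    Tendsto (fun τ : ℍ => ModularForm.E hk τ) atImInfty (𝓝 1) := by
  have h1 : (qExpansion 1 (ModularForm.E hk)).coeff 0 = 1 := E_qExpansion_coeff_zero hk hk2
  rw [qExpansion_coeff] at h1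
  simp only [Nat.factorial_zero, Nat.cast_one, inv_one, one_mul, iteratedDeriv_zero] at h1
  have h2 : ContinuousAt (cuspFunction 1 (ModularForm.E hk)) 0 :=
    (ModularFormClass.analyticAt_cuspFunction_zero (ModularForm.E hk) one_pos
      one_mem_strictPeriods_SL).continuousAt
  have h3 := (h2.tendsto.comp (qParam_tendsto_atImInfty one_pos))
  rw [h1] at h3
  refine h3.congr fun τ => ?_
  exact SlashInvariantFormClass.eq_cuspFunction (ModularForm.E hk) τ one_mem_strictPeriods_SL one_ne_zero

/-- `a E₄³ - b E₆²` as a modular form. -/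
noncomputable def E4E6Form (a b : ℂ) : ModularForm 𝒮ℒ 12 :=
  a • ModularForm.mcast (by decide) (E₄.pow 3) - b • ModularForm.mcast (by decide) (E₆.pow 2)

/-- The combination `a E₄³ - b E₆²` with `a ≠ b` has a zero in the upper half plane. -/
theorem exists_E4E6Form_eq_zero {a b : ℂ} (hab : a ≠ b) :
    ∃ τ : ℍ, a * E₄ τ ^ 3 = b * E₆ τ ^ 2 := by
  by_contra! hne
  have hf : ∀ τ : ℍ, E4E6Form a b τ ≠ 0 := fun τ h => hne τ (sub_eq_zero.1 h)
  have hslash : ∀ γ : SL(2, ℤ), (fun z => E₄ z / E4E6Form a b z) ∣[(4 - 12 : ℤ)] γ =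
      fun z => E₄ z / E4E6Form a b z := by
    intro γ
    have hγ : (γ : GL (Fin 2) ℝ) ∈ 𝒮ℒ := ⟨γ, rfl⟩
    change (⇑E₄ / ⇑(E4E6Form a b)) ∣[(4 - 12 : ℤ)] γ = ⇑E₄ / ⇑(E4E6Form a b)
    simp_rw [div_slash_SL2, SL_slash]
    congr 1
    · exact slash_action_eqn E₄ _ hγ
    · exact slash_action_eqn (E4E6Form a b) _ hγ
  -- Without a zero, dividing `E₄` by the weight 12 form would give a level one form of weight `-8`.
  -- It is bounded at the cusp because the denominator tends to `a - b ≠ 0`.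
  let g : ModularForm 𝒮ℒ (4 - 12) :=
    { toFun z := E₄ z / E4E6Form a b z
      slash_action_eq' := fun _ ⟨γ, hγ⟩ => hγ ▸ hslash γ
      holo' := E₄.holo'.div (E4E6Form a b).holo' hf
      bdd_at_cusps' {c} hc := by
        rw [Subgroup.IsArithmetic.isCusp_iff_isCusp_SL2Z] at hc
        rw [isBoundedAt_iff_forall_SL2Z hc]
        intro γ _
        rw [hslash γ, IsBoundedAtImInfty, BoundedAtFilter]
        have h4 := tendsto_E_atImInfty (k := 4) (by norm_num) (by decide)
        have h6 := tendsto_E_atImInfty (k := 6) (by norm_num) (by decide)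
        have hne : a * 1 ^ 3 - b * 1 ^ 2 ≠ 0 := by simpa [sub_eq_zero] using hab
        have := h4.div (((h4.pow 3).const_mul a).sub ((h6.pow 2).const_mul b)) hne
        exact this.isBigO_one ℝ }
  have hg : ⇑g = 0 := levelOne_neg_weight_eq_zero (by norm_num) g
  have h4 : (E₄ : ModularForm 𝒮ℒ 4) = 0 := by
    ext z
    have := congrFun hg z
    exact (div_eq_zero_iff.1 this).resolve_right (hf z)
  exact E_ne_zero _ (by decide) h4

theorem riemannZeta_six : riemannZeta 6 = (Real.pi : ℂ) ^ 6 / 945 := by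
  have h := riemannZeta_two_mul_nat (k := 3) (by norm_num)
  have hb : bernoulli 6 = 1 / 42 := by decide +kernel
  norm_num [hb, Nat.factorial] at h
  rw [h]
  ring

/-- The period pair `t τ, t`. -/
noncomputable def pairOf (t : ℂ) (ht : t ≠ 0) (τ : ℍ) : PeriodPair where
  ω₁ := t * τ
  ω₂ := t
  indep := by
    rw [LinearIndependent.pair_iff]
    intro a b h
    have h1 : (a : ℂ) * τ + b = 0 := by
      refine mul_left_cancel₀ ht ?_
      simp only [Complex.real_smul] at h
      linear_combination h
    have h2 := congrArg Complex.im h1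
    have hτ := τ.im_ne_zero
    simp [hτ] at h2
    subst h2
    simpa using h1

/-- The factor `t` comes out of every lattice vector `t(mτ + n)`, and the remaining sum is the full
Eisenstein series, which is `2ζ(k)` times the normalised one. -/
theorem G_pairOf {t : ℂ} (ht : t ≠ 0) (τ : ℍ) {k : ℕ} (hk : 3 ≤ k) :
    (pairOf t ht τ).G k = (t ^ k)⁻¹ * (2 * riemannZeta k * ModularForm.E hk τ) := by
  have h1 : ModularForm.E hk τ = (1 / 2 : ℂ) * eisensteinSeries (N := 1) 0 k τ := rfl
  have h2 := tsum_eisSummand_eq_riemannZeta_mul_eisensteinSeries hk τ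
  have h3 : 2 * riemannZeta k * ModularForm.E hk τ = ∑' v : Fin 2 → ℤ, eisSummand k v τ := by
    rw [h1, h2]; ring
  rw [h3, PeriodPair.G, ← tsum_mul_left, ← (pairOf t ht τ).latticeEquivProd.symm.toEquiv.tsum_eq,
    ← (finTwoArrowEquiv ℤ).tsum_eq]
  congr 1 with v
  have := (pairOf t ht τ).latticeEquiv_symm_apply (finTwoArrowEquiv ℤ v)
  simp only [LinearEquiv.coe_toEquiv]
  rw [this]
  simp only [pairOf, eisSummand, finTwoArrowEquiv_apply, zpow_neg, zpow_natCast]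
  rw [← mul_inv, ← mul_pow]
  congr 2
  change (v 0 : ℂ) * (t * τ) + (v 1 : ℂ) * t = t * (v 0 * τ + v 1)
  ring

theorem g₂_pairOf {t : ℂ} (ht : t ≠ 0) (τ : ℍ) :
    (pairOf t ht τ).g₂ = (t⁻¹) ^ 4 * (4 / 3 * (Real.pi : ℂ) ^ 4 * E₄ τ) := by
  have h := G_pairOf ht τ (k := 4) (by norm_num)
  rw [PeriodPair.g₂, h, Nat.cast_ofNat, riemannZeta_four, inv_pow]
  ring

theorem g₃_pairOf {t : ℂ} (ht : t ≠ 0) (τ : ℍ) :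
    (pairOf t ht τ).g₃ = (t⁻¹) ^ 6 * (8 / 27 * (Real.pi : ℂ) ^ 6 * E₆ τ) := by
  have h := G_pairOf ht τ (k := 6) (by norm_num)
  rw [PeriodPair.g₃, h, Nat.cast_ofNat, riemannZeta_six, inv_pow]
  ring

/-- Invariants with the same ratio `A³ : B²` differ by scaling the lattice. A fourth root fixes `A`,
leaving only the sign of `B` open; multiplying `s` by `i` changes that sign. When `a = 0` a sixth
root is used instead. -/
theorem exists_scale {A B a b : ℂ} (hab : a ^ 3 ≠ 27 * b ^ 2) (hAB : A ^ 3 ≠ 27 * B ^ 2)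
    (h : A ^ 3 * b ^ 2 = B ^ 2 * a ^ 3) : ∃ s : ℂ, s ≠ 0 ∧ s ^ 4 * A = a ∧ s ^ 6 * B = b := by
  by_cases ha : a = 0
  · subst ha
    have hb : b ≠ 0 := by rintro rfl; simp at hab
    have hA : A = 0 := by simpa [hb] using h
    subst hA
    have hB : B ≠ 0 := by rintro rfl; simp at hAB
    obtain ⟨s, hs⟩ := IsAlgClosed.exists_pow_nat_eq (b / B) (n := 6) (by norm_num)
    refine ⟨s, ?_, by simp, by rw [hs]; field_simp⟩
    rintro rfl
    rw [zero_pow (by norm_num)] at hs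
    exact div_ne_zero hb hB hs.symm
  · have hA : A ≠ 0 := by
      rintro rfl
      have : B = 0 := by simpa [ha] using h.symm
      simp [this] at hAB
    obtain ⟨s, hs⟩ := IsAlgClosed.exists_pow_nat_eq (a / A) (n := 4) (by norm_num)
    have hs4 : s ^ 4 * A = a := by rw [hs]; field_simp
    have hs0 : s ≠ 0 := by
      rintro rfl
      simp at hs4
      exact ha hs4.symm
    have h2 : (s ^ 6 * B) ^ 2 = b ^ 2 := by
      refine mul_left_cancel₀ (pow_ne_zero 3 hA) ?_
      rw [h, ← hs4]
      ring
    rcases sq_eq_sq_iff_eq_or_eq_neg.1 h2 with h3 | h3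
    · exact ⟨s, hs0, hs4, h3⟩
    · refine ⟨Complex.I * s, mul_ne_zero Complex.I_ne_zero hs0, ?_, ?_⟩
      · rw [mul_pow, Complex.I_pow_four, one_mul, hs4]
      · rw [mul_pow, show (6 : ℕ) = 4 + 2 by norm_num, pow_add Complex.I, Complex.I_pow_four,
          Complex.I_sq]
        linear_combination -h3

/-- Every nonsingular curve is uniformized by a lattice. -/
theorem exists_isPeriodPairOf {l4 l6 : ℂ} (h : IsNonsingular l4 l6) :
    ∃ L : PeriodPair, IsPeriodPairOf L l4 l6 := by
  have hpi : (Real.pi : ℂ) ≠ 0 := Complex.ofReal_ne_zero.2 Real.pi_ne_zero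
  have hab : (-4 * l4) ^ 3 ≠ 27 * (-4 * l6) ^ 2 := fun e => h (by linear_combination -e / 16)
  -- For the lattice of `τ` the ratio `g₂³ : 27g₃²` equals `E₄³ : E₆²`, so this zero is a `τ` with
  -- the prescribed ratio; `a ≠ b` is nonsingularity of the curve.
  obtain ⟨τ, hτ⟩ := exists_E4E6Form_eq_zero (a := 27 * (-4 * l6) ^ 2) (b := (-4 * l4) ^ 3) hab.symm
  have hAB : (4 / 3 * (Real.pi : ℂ) ^ 4 * E₄ τ) ^ 3 ≠ 27 * (8 / 27 * (Real.pi : ℂ) ^ 6 * E₆ τ) ^ 2 := by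
    have h1 := discriminant_eq_E₄_cube_sub_E₆_sq τ
    have h2 := discriminant_ne_zero τ
    intro e
    apply h2
    rw [h1]
    have : (Real.pi : ℂ) ^ 12 * (E₄ τ ^ 3 - E₆ τ ^ 2) = 0 := by linear_combination 27 / 64 * e
    rw [(mul_eq_zero.1 this).resolve_left (pow_ne_zero _ hpi), zero_div]
  obtain ⟨s, hs0, h4, h6⟩ := exists_scale hab hAB
    (by linear_combination (64 / 729) * (Real.pi : ℂ) ^ 12 * hτ)
  refine ⟨pairOf s⁻¹ (inv_ne_zero hs0) τ, ?_, ?_⟩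
  · rw [g₂_pairOf, inv_inv, h4]
  · rw [g₃_pairOf, inv_inv, h6]

theorem periods_spec {l4 l6 : ℂ} (h : IsNonsingular l4 l6) :
    IsPeriodPairOf (periods l4 l6) l4 l6 :=
  Classical.epsilon_spec (exists_isPeriodPairOf h)

theorem isRegular_periods {l4 l6 : ℂ} (h : IsNonsingular l4 l6) :
    IsRegular (periods l4 l6) := by
  obtain ⟨h2, h3⟩ := periods_spec h
  rw [IsRegular, h2, h3]
  intro e
  exact h (by linear_combination -e / 16)

end Existence
end EllipticDer

namespace EllipticDer
open Filter Topology

/-! ### Power series in two variables with bounded coefficients -/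

section DoubleSeries

/-- The multilinear form whose diagonal is `a ^ i * b ^ (n - i)`. -/
noncomputable def monomialForm (n i : ℕ) : ContinuousMultilinearMap ℂ (fun _ : Fin n => ℂ × ℂ) ℂ :=
  (ContinuousMultilinearMap.mkPiAlgebra ℂ (Fin n) ℂ).compContinuousLinearMap
    (fun t => if (t : ℕ) < i then ContinuousLinearMap.fst ℂ ℂ ℂ else ContinuousLinearMap.snd ℂ ℂ ℂ)

theorem norm_monomialForm_le (n i : ℕ) : ‖monomialForm n i‖ ≤ 1 := by
  refine (ContinuousMultilinearMap.norm_compContinuousLinearMap_le _ _).trans ?_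
  have h1 : ‖ContinuousMultilinearMap.mkPiAlgebra ℂ (Fin n) ℂ‖ ≤ 1 :=
    ContinuousMultilinearMap.norm_mkPiAlgebra.le
  refine mul_le_one₀ h1 (Finset.prod_nonneg fun _ _ => norm_nonneg _) ?_
  refine Finset.prod_le_one (fun _ _ => norm_nonneg _) fun t _ => ?_
  split_ifs
  · exact ContinuousLinearMap.norm_fst_le ..
  · exact ContinuousLinearMap.norm_snd_le ..

theorem monomialForm_apply {n i : ℕ} (hi : i ≤ n) (x : ℂ × ℂ) :
    monomialForm n i (fun _ => x) = x.1 ^ i * x.2 ^ (n - i) := by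
  have h : monomialForm n i (fun _ => x) = ∏ t : Fin n, if (t : ℕ) < i then x.1 else x.2 := by
    simp only [monomialForm, ContinuousMultilinearMap.compContinuousLinearMap_apply,
      ContinuousMultilinearMap.mkPiAlgebra_apply]
    refine Finset.prod_congr rfl fun t _ => ?_
    split_ifs <;> rfl
  rw [h, Fin.prod_univ_eq_prod_range (fun t => if t < i then x.1 else x.2) n,
    ← Finset.prod_range_mul_prod_Ico _ hi]
  congr 1
  · rw [Finset.prod_congr rfl (g := fun _ => x.1) (fun t ht => if_pos (Finset.mem_range.1 ht))]
    simp
  · rw [Finset.prod_congr rfl (g := fun _ => x.2)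
      (fun t ht => if_neg (not_lt.2 (Finset.mem_Ico.1 ht).1))]
    simp

theorem summable_double {c : ℕ × ℕ → ℂ} (hc : ∀ ij, ‖c ij‖ ≤ 1) {x : ℂ × ℂ} (hx : ‖x‖ < 1) :
    Summable fun ij : ℕ × ℕ => c ij * (x.1 ^ ij.1 * x.2 ^ ij.2) := by
  have h1 : ‖x.1‖ < 1 := (norm_fst_le x).trans_lt hx
  have h2 : ‖x.2‖ < 1 := (norm_snd_le x).trans_lt hx
  refine Summable.of_norm_bounded (g := fun ij : ℕ × ℕ => ‖x.1‖ ^ ij.1 * ‖x.2‖ ^ ij.2) ?_ fun ij => ?_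
  · exact (summable_geometric_of_lt_one (norm_nonneg _) h1).mul_of_nonneg
      (summable_geometric_of_lt_one (norm_nonneg _) h2) (fun _ => by positivity)
      (fun _ => by positivity)
  · rw [norm_mul, norm_mul, norm_pow, norm_pow]
    exact mul_le_of_le_one_left (by positivity) (hc ij)

/-- Grouping by total degree gives a homogeneous part of degree `n` made of `n + 1` forms of norm at
most `1`, so the radius is at least `1`. Absolute convergence permits the regrouping. -/
theorem analyticOnNhd_double {c : ℕ × ℕ → ℂ} (hc : ∀ ij, ‖c ij‖ ≤ 1) :
    AnalyticOnNhd ℂ (fun x : ℂ × ℂ => ∑' ij : ℕ × ℕ, c ij * (x.1 ^ ij.1 * x.2 ^ ij.2))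
      (Metric.ball 0 1) := by
  let p : FormalMultilinearSeries ℂ (ℂ × ℂ) ℂ := fun n =>
    ∑ i ∈ Finset.range (n + 1), c (i, n - i) • monomialForm n i
  have hp : ∀ n, ‖p n‖ ≤ n + 1 := fun n => by
    refine (norm_sum_le _ _).trans ?_
    refine (Finset.sum_le_card_nsmul _ _ 1 fun i _ => ?_).trans (by simp)
    rw [norm_smul]
    exact mul_le_one₀ (hc _) (norm_nonneg _) (norm_monomialForm_le n i)
  have hrad : 1 ≤ p.radius := by
    refine ENNReal.le_of_forall_nnreal_lt fun r hr => ?_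
    have hr1 : (r : ℝ) < 1 := by exact_mod_cast hr
    refine p.le_radius_of_summable_norm (Summable.of_nonneg_of_le (fun n => by positivity)
      (fun n => mul_le_mul_of_nonneg_right (hp n) (by positivity))
      (f := fun n : ℕ => ((n : ℝ) + 1) * (r : ℝ) ^ n) ?_)
    have h1 := summable_pow_mul_geometric_of_norm_lt_one 1 (r := (r : ℝ)) (by simpa using hr1)
    have h2 := summable_geometric_of_lt_one r.2 hr1
    refine (h1.add h2).congr fun n => ?_
    simp
    ring
  have hser := (p.hasFPowerSeriesOnBall (lt_of_lt_of_le one_pos hrad)).mono one_pos hrad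
  have hsum : ∀ x ∈ Metric.ball (0 : ℂ × ℂ) 1,
      p.sum x = ∑' ij : ℕ × ℕ, c ij * (x.1 ^ ij.1 * x.2 ^ ij.2) := by
    intro x hx
    have hs := summable_double hc (mem_ball_zero_iff.1 hx)
    rw [← Finset.HasAntidiagonal.sigmaAntidiagonalEquivProd.tsum_eq]
    refine Eq.trans ?_ (Summable.tsum_sigma' (fun n => (hasSum_fintype _).summable)
      ((Equiv.summable_iff Finset.HasAntidiagonal.sigmaAntidiagonalEquivProd).2 hs)).symm
    refine tsum_congr fun n => ?_
    rw [tsum_fintype, Finset.univ_eq_attach]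
    simp only [Function.comp_apply, Finset.HasAntidiagonal.sigmaAntidiagonalEquivProd_apply]
    rw [Finset.sum_attach (Finset.HasAntidiagonal.antidiagonal n)
      (fun ij => c ij * (x.1 ^ ij.1 * x.2 ^ ij.2)), Finset.Nat.sum_antidiagonal_eq_sum_range_succ_mk]
    simp only [p, _root_.sum_apply, _root_.smul_apply,
      smul_eq_mul]
    refine Finset.sum_congr rfl fun i hi => ?_
    rw [monomialForm_apply (Nat.lt_succ_iff.1 (Finset.mem_range.1 hi))]
  have hball : Metric.ball (0 : ℂ × ℂ) 1 = Metric.eball 0 1 := by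
    rw [← ENNReal.ofReal_one, Metric.eball_ofReal]
  intro x hx
  refine (hser.analyticOnNhd x (hball ▸ hx)).congr ?_
  filter_upwards [Metric.isOpen_ball.mem_nhds hx] with y hy
  exact hsum y hy

end DoubleSeries

/-! ### The universal Laurent coefficients of `℘` -/

section Universal

open MvPolynomial
open scoped NNReal

/-- The coefficient of `u ^ (2 m)` in `℘(u) - u⁻²`, as a polynomial in `g₂` and `g₃`. -/
noncomputable def wpPoly : ℕ → MvPolynomial (Fin 2) ℝ≥0
  | 0 => 0
  | 1 => C (1 / 20) * MvPolynomial.X 0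
  | 2 => C (1 / 28) * MvPolynomial.X 1
  -- From `℘'' = 6℘² - g₂/2`: with `k = m + 3`, the coefficient `c_k` of `u^(2k)` satisfies
  -- `(2k(2k-1) - 12) c_k = 6 ∑ c_i c_(k-1-i)`, and the left factor is `(2k-4)(2k+3)`.
  | (m + 3) => C (6 / ((2 * m + 2) * (2 * m + 9)) : ℝ≥0) *
      ∑ i : Fin (m + 3), wpPoly i * wpPoly (m + 2 - i)
  decreasing_by
    · exact i.2
    · omega

theorem wpPoly_succ (m : ℕ) : wpPoly (m + 3) = C (6 / ((2 * m + 2) * (2 * m + 9)) : ℝ≥0) *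
    ∑ i ∈ Finset.range (m + 3), wpPoly i * wpPoly (m + 2 - i) := by
  rw [wpPoly, Finset.sum_range]

/-- With weights `2` and `3`, each monomial in `g₂`, `g₃` can occur in only one `wpPoly m`, so the
polynomials assemble into a single power series. -/
theorem isWeightedHomogeneous_wpPoly (m : ℕ) :
    IsWeightedHomogeneous ![2, 3] (wpPoly m) (m + 1) := by
  induction m using Nat.strong_induction_on with
  | _ m ih =>
    match m, ih with
    | 0, _ => rw [wpPoly]; exact isWeightedHomogeneous_zero _ _ _
    | 1, _ => rw [wpPoly]; exact (isWeightedHomogeneous_X ℝ≥0 ![2, 3] 0).C_mul _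
    | 2, _ => rw [wpPoly]; exact (isWeightedHomogeneous_X ℝ≥0 ![2, 3] 1).C_mul _
    | (m + 3), ih =>
      rw [wpPoly_succ]
      refine IsWeightedHomogeneous.C_mul (IsWeightedHomogeneous.sum _ _ _ fun i hi => ?_) _
      have hi := Finset.mem_range.1 hi
      have := (ih i hi).mul (ih (m + 2 - i) (by omega))
      rwa [show i + 1 + (m + 2 - i + 1) = m + 3 + 1 by omega] at this

/-- The induction closes because `6(m + 3) ≤ (2m + 2)(2m + 9)`. As the coefficients are nonnegative,
the value at `(1, 1)` bounds each of them. -/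
theorem eval_wpPoly_le_one (m : ℕ) : eval 1 (wpPoly m) ≤ 1 := by
  induction m using Nat.strong_induction_on with
  | _ m ih =>
    match m, ih with
    | 0, _ => simp [wpPoly]
    | 1, _ =>
      simp only [wpPoly, map_mul, eval_C, eval_X, Pi.one_apply, mul_one]
      rw [← NNReal.coe_le_coe]; push_cast; norm_num
    | 2, _ =>
      simp only [wpPoly, map_mul, eval_C, eval_X, Pi.one_apply, mul_one]
      rw [← NNReal.coe_le_coe]; push_cast; norm_num
    | (m + 3), ih =>
      rw [wpPoly_succ, map_mul, eval_C, map_sum]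
      have h1 : ∑ i ∈ Finset.range (m + 3), eval 1 (wpPoly i * wpPoly (m + 2 - i)) ≤ m + 3 := by
        refine (Finset.sum_le_card_nsmul _ _ 1 fun i hi => ?_).trans (by simp)
        have hi := Finset.mem_range.1 hi
        rw [map_mul]
        exact mul_le_one₀ (ih i hi) zero_le (ih (m + 2 - i) (by omega))
      refine (mul_le_mul_right h1 _).trans ?_
      rw [div_mul_eq_mul_div, div_le_one₀ (by positivity), ← NNReal.coe_le_coe]
      push_cast
      have : (0 : ℝ) ≤ m := Nat.cast_nonneg m
      nlinarith

theorem coeff_wpPoly_le_one (m : ℕ) (s : Fin 2 →₀ ℕ) : coeff s (wpPoly m) ≤ 1 := by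
  refine le_trans ?_ (eval_wpPoly_le_one m)
  rw [eval_eq]
  simp only [Pi.one_apply, one_pow, Finset.prod_const_one, mul_one]
  by_cases hs : s ∈ (wpPoly m).support
  · exact Finset.single_le_sum (f := fun d => coeff d (wpPoly m)) (fun _ _ => zero_le) hs
  · rw [notMem_support_iff.1 hs]
    exact zero_le

theorem aeval_wpPoly_mul (g2 g3 u : ℂ) (m : ℕ) :
    aeval ![g2 * u ^ 4, g3 * u ^ 6] (wpPoly m) = u ^ (2 * m + 2) * aeval ![g2, g3] (wpPoly m) := by
  induction m using Nat.strong_induction_on with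
  | _ m ih =>
    match m, ih with
    | 0, _ => simp [wpPoly]
    | 1, _ => simp [wpPoly]; ring
    | 2, _ => simp [wpPoly]; ring
    | (m + 3), ih =>
      rw [wpPoly_succ]
      simp only [map_mul, map_sum]
      have hsum : ∑ i ∈ Finset.range (m + 3), aeval ![g2 * u ^ 4, g3 * u ^ 6] (wpPoly i) *
          aeval ![g2 * u ^ 4, g3 * u ^ 6] (wpPoly (m + 2 - i)) =
          u ^ (2 * (m + 3) + 2) * ∑ i ∈ Finset.range (m + 3), aeval ![g2, g3] (wpPoly i) *
            aeval ![g2, g3] (wpPoly (m + 2 - i)) := by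
        rw [Finset.mul_sum]
        refine Finset.sum_congr rfl fun i hi => ?_
        have hi := Finset.mem_range.1 hi
        rw [ih i hi, ih (m + 2 - i) (by omega),
          show 2 * (m + 3) + 2 = (2 * i + 2) + (2 * (m + 2 - i) + 2) by omega, pow_add]
        ring
      rw [hsum, aeval_C, aeval_C]
      ring

/-- The exponent vector `(i, j)`. -/
noncomputable def expVec (ij : ℕ × ℕ) : Fin 2 →₀ ℕ := Finsupp.equivFunOnFinite.symm ![ij.1, ij.2]

/-- The coefficients of the universal series with weights `r`. -/
noncomputable def univCoeff (r : ℕ → ℂ) (ij : ℕ × ℕ) : ℂ :=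
  -- At `(0, 0)` the truncated subtraction gives index `0`; this is harmless since `wpPoly 0 = 0`.
  r (2 * ij.1 + 3 * ij.2 - 1) *
    algebraMap ℝ≥0 ℂ (coeff (expVec ij) (wpPoly (2 * ij.1 + 3 * ij.2 - 1)))

/-- The universal series `∑ r m * wpPoly m`. -/
noncomputable def univSeries (r : ℕ → ℂ) (x : ℂ × ℂ) : ℂ :=
  ∑' ij : ℕ × ℕ, univCoeff r ij * (x.1 ^ ij.1 * x.2 ^ ij.2)

theorem norm_univCoeff_le {r : ℕ → ℂ} (hr : ∀ m, ‖r m‖ ≤ 1) (ij : ℕ × ℕ) :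
    ‖univCoeff r ij‖ ≤ 1 := by
  rw [univCoeff, norm_mul]
  refine mul_le_one₀ (hr _) (norm_nonneg _) ?_
  change ‖(((coeff _ _ : ℝ≥0) : ℝ) : ℂ)‖ ≤ 1
  rw [Complex.norm_real, Real.norm_of_nonneg (NNReal.coe_nonneg _)]
  exact_mod_cast coeff_wpPoly_le_one _ _

theorem analyticOnNhd_univSeries {r : ℕ → ℂ} (hr : ∀ m, ‖r m‖ ≤ 1) :
    AnalyticOnNhd ℂ (univSeries r) (Metric.ball 0 1) :=
  analyticOnNhd_double (norm_univCoeff_le hr)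

theorem expVec_bijective : Function.Bijective expVec := by
  constructor
  · intro a b h
    have h0 := DFunLike.congr_fun h 0
    have h1 := DFunLike.congr_fun h 1
    exact Prod.ext h0 h1
  · intro s
    refine ⟨(s 0, s 1), ?_⟩
    ext i
    fin_cases i <;> rfl

theorem hasSum_wpPoly (m : ℕ) (x : ℂ × ℂ) :
    HasSum (fun ij : ℕ × ℕ => algebraMap ℝ≥0 ℂ (coeff (expVec ij) (wpPoly m)) * (x.1 ^ ij.1 * x.2 ^ ij.2))
      (aeval ![x.1, x.2] (wpPoly m)) := by
  have h : HasSum (fun s : Fin 2 →₀ ℕ => algebraMap ℝ≥0 ℂ (coeff s (wpPoly m)) * (x.1 ^ s 0 * x.2 ^ s 1))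
      (aeval ![x.1, x.2] (wpPoly m)) := by
    rw [aeval_def, eval₂_eq']
    simp only [Fin.prod_univ_two, Matrix.cons_val_zero, Matrix.cons_val_one]
    refine hasSum_sum_of_ne_finset_zero fun s hs => ?_
    rw [notMem_support_iff.1 hs]
    simp
  exact (Equiv.ofBijective _ expVec_bijective).hasSum_iff.2 h

/-- The absolutely convergent double series is regrouped along the fibres of `2i + 3j - 1`; by
weighted homogeneity the fibre over `m` carries exactly `wpPoly m`. -/
theorem hasSum_univSeries {r : ℕ → ℂ} (hr : ∀ m, ‖r m‖ ≤ 1) {x : ℂ × ℂ} (hx : ‖x‖ < 1) :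
    HasSum (fun m => r m * aeval ![x.1, x.2] (wpPoly m)) (univSeries r x) := by
  have h := (summable_double (norm_univCoeff_le hr) hx).hasSum.tsum_fiberwise
    (fun ij : ℕ × ℕ => 2 * ij.1 + 3 * ij.2 - 1)
  convert! h using 2 with m
  rw [tsum_subtype ((fun ij : ℕ × ℕ => 2 * ij.1 + 3 * ij.2 - 1) ⁻¹' {m})
    (fun ij : ℕ × ℕ => univCoeff r ij * (x.1 ^ ij.1 * x.2 ^ ij.2)),
    ← (hasSum_wpPoly m x).tsum_eq, ← tsum_mul_left]
  refine tsum_congr fun ij => ?_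
  by_cases hm : 2 * ij.1 + 3 * ij.2 - 1 = m
  · rw [Set.indicator_of_mem (by exact hm), univCoeff, hm]
    ring
  · rw [Set.indicator_of_notMem (by exact hm)]
    have : coeff (expVec ij) (wpPoly m) = 0 := by
      refine (isWeightedHomogeneous_wpPoly m).coeff_eq_zero _ fun e => hm ?_
      rw [Finsupp.weight_apply, Finsupp.sum_fintype _ _ (by simp)] at e
      simp [expVec] at e
      omega
    simp [this]

end Universal
end EllipticDer

namespace EllipticDer
open Filter Topology PeriodPair

/-! ### Taylor series at the origin -/

section Taylor

/-- The Taylor series at the origin. -/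
noncomputable def taylorAtZero (f : ℂ → ℂ) : PowerSeries ℂ :=
  PowerSeries.mk fun n => iteratedDeriv n f 0 / n.factorial

theorem coeff_taylorAtZero (f : ℂ → ℂ) (n : ℕ) :
    (taylorAtZero f).coeff n = iteratedDeriv n f 0 / n.factorial := PowerSeries.coeff_mk _ _

theorem taylorAtZero_congr {f g : ℂ → ℂ} (h : f =ᶠ[𝓝 0] g) : taylorAtZero f = taylorAtZero g := by
  ext n
  rw [coeff_taylorAtZero, coeff_taylorAtZero, h.iteratedDeriv_eq]

theorem taylorAtZero_add {f g : ℂ → ℂ} (hf : AnalyticAt ℂ f 0) (hg : AnalyticAt ℂ g 0) :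
    taylorAtZero (f + g) = taylorAtZero f + taylorAtZero g := by
  ext n
  rw [map_add, coeff_taylorAtZero, coeff_taylorAtZero, coeff_taylorAtZero,
    iteratedDeriv_add hf.contDiffAt hg.contDiffAt, add_div]

theorem taylorAtZero_const (c : ℂ) : taylorAtZero (fun _ => c) = PowerSeries.C c := by
  ext n
  rw [coeff_taylorAtZero, iteratedDeriv_const, PowerSeries.coeff_C]
  split_ifs with h
  · simp [h]
  · simp

theorem taylorAtZero_mul {f g : ℂ → ℂ} (hf : AnalyticAt ℂ f 0) (hg : AnalyticAt ℂ g 0) :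
    taylorAtZero (f * g) = taylorAtZero f * taylorAtZero g := by
  ext n
  rw [coeff_taylorAtZero, iteratedDeriv_mul hf.contDiffAt hg.contDiffAt, PowerSeries.coeff_mul,
    Finset.Nat.sum_antidiagonal_eq_sum_range_succ_mk, Finset.sum_div]
  refine Finset.sum_congr rfl fun i hi => ?_
  have hi := Nat.lt_succ_iff.1 (Finset.mem_range.1 hi)
  simp only [coeff_taylorAtZero]
  have h := Nat.choose_mul_factorial_mul_factorial hi
  have h' : (n.choose i : ℂ) * i.factorial * (n - i).factorial = n.factorial := by exact_mod_cast h
  have h1 : (i.factorial : ℂ) ≠ 0 := by exact_mod_cast i.factorial_ne_zero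
  have h2 : ((n - i).factorial : ℂ) ≠ 0 := by exact_mod_cast (n - i).factorial_ne_zero
  have h3 : (n.factorial : ℂ) ≠ 0 := by exact_mod_cast n.factorial_ne_zero
  field_simp
  rw [← h']
  ring

theorem taylorAtZero_id : taylorAtZero (fun z => z) = PowerSeries.X := by
  ext n
  rw [coeff_taylorAtZero, PowerSeries.coeff_X]
  match n with
  | 0 => simp
  | 1 => simp
  | (n + 2) =>
    rw [iteratedDeriv_succ', iteratedDeriv_succ']
    simp

theorem coeff_taylorAtZero_deriv (f : ℂ → ℂ) (n : ℕ) :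
    (taylorAtZero (deriv f)).coeff n = (taylorAtZero f).coeff (n + 1) * (n + 1) := by
  rw [coeff_taylorAtZero, coeff_taylorAtZero, ← iteratedDeriv_succ', Nat.factorial_succ]
  have h3 : (n.factorial : ℂ) ≠ 0 := by exact_mod_cast n.factorial_ne_zero
  have h4 : (n : ℂ) + 1 ≠ 0 := by exact_mod_cast n.succ_ne_zero
  push_cast
  field_simp

theorem eventually_hasSum_taylorAtZero {f : ℂ → ℂ} (hf : AnalyticAt ℂ f 0) :
    ∀ᶠ z in 𝓝 0, HasSum (fun n => z ^ n * (taylorAtZero f).coeff n) (f z) := by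
  filter_upwards [hasFPowerSeriesAt_iff.1 hf.hasFPowerSeriesAt] with z hz
  simpa [coeff_taylorAtZero, FormalMultilinearSeries.coeff_ofScalars] using hz

end Taylor

/-! ### The Laurent coefficients of the Weierstrass functions -/

section Laurent

variable (L : PeriodPair)

theorem coeff_taylorAtZero_weierstrassPExcept (n : ℕ) (hn : n ≠ 0) :
    (taylorAtZero ℘[L - (0 : ℂ)]).coeff n = (n + 1) * L.G (n + 2) := by
  rw [coeff_taylorAtZero, iteratedDeriv_weierstrassPExcept_self, if_neg hn, sumInvPow_zero,
    Nat.factorial_succ]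
  have h3 : (n.factorial : ℂ) ≠ 0 := by exact_mod_cast n.factorial_ne_zero
  push_cast
  field_simp

theorem coeff_zero_taylorAtZero_weierstrassPExcept :
    (taylorAtZero ℘[L - (0 : ℂ)]).coeff 0 = 0 := by
  rw [coeff_taylorAtZero, iteratedDeriv_weierstrassPExcept_self]
  simp

theorem coeff_odd_taylorAtZero_weierstrassPExcept {n : ℕ} (hn : Odd n) :
    (taylorAtZero ℘[L - (0 : ℂ)]).coeff n = 0 := by
  rw [coeff_taylorAtZero_weierstrassPExcept L n hn.pos.ne',
    L.G_eq_zero_of_odd _ (hn.add_even even_two), mul_zero]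

/-- Substituting `℘ = z⁻² + f` in `℘'' = 6℘² - g₂/2` cancels the `z⁻⁴` terms; the factor `z²` clears
the remaining pole, so the identity can be read on Taylor series. -/
theorem eventually_deriv_deriv_weierstrassPExcept :
    (fun z => z * z * deriv (deriv ℘[L - (0 : ℂ)]) z + L.g₂ / 2 * (z * z)) =ᶠ[𝓝 0]
      fun z => 12 * ℘[L - (0 : ℂ)] z + 6 * (z * z) * (℘[L - (0 : ℂ)] z * ℘[L - (0 : ℂ)] z) := by
  have h1 := L.compl_lattice_sdiff_singleton_mem_nhds 0
  have h2 : deriv ℘[L - (0 : ℂ)] =ᶠ[𝓝 0] ℘'[L - (0 : ℂ)] := by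
    filter_upwards [h1] with z hz
    exact L.eqOn_deriv_weierstrassPExcept_derivWeierstrassPExcept 0 hz
  filter_upwards [h1, h2.eventuallyEq_nhds] with z hz hz2
  rw [hz2.deriv_eq]
  by_cases h0 : z = 0
  · simp [h0]
  have hzL : z ∉ L.lattice := fun h => hz ⟨h, h0⟩
  have h3 : HasDerivAt ℘'[L - (0 : ℂ)] (6 * ℘[L] z ^ 2 - L.g₂ / 2 - 6 / z ^ 4) z := by
    have h4 := (hasDerivAt_derivWeierstrassP L hzL).add
      (((hasDerivAt_id z).fun_pow 3).fun_inv (pow_ne_zero 3 h0) |>.const_mul 2)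
    refine (h4.congr_deriv ?_).congr_of_eventuallyEq (Eventually.of_forall fun w => ?_)
    · simp only [id]
      field_simp
      push_cast
      ring
    · simp only [Pi.add_apply, id]
      rw [derivWeierstrassP_eq]
      ring
  rw [h3.deriv, weierstrassP_eq]
  field_simp
  ring

theorem analyticAt_weierstrassPExcept_zero : AnalyticAt ℂ ℘[L - (0 : ℂ)] 0 :=
  L.analyticAt_weierstrassPExcept 0

theorem taylorAtZero_weierstrassPExcept_ode :
    PowerSeries.X ^ 2 * taylorAtZero (deriv (deriv ℘[L - (0 : ℂ)])) +
        PowerSeries.C (L.g₂ / 2) * PowerSeries.X ^ 2 =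
      PowerSeries.C 12 * taylorAtZero ℘[L - (0 : ℂ)] +
        PowerSeries.C 6 * (PowerSeries.X ^ 2 * taylorAtZero ℘[L - (0 : ℂ)] ^ 2) := by
  have hf := analyticAt_weierstrassPExcept_zero L
  have hi : AnalyticAt ℂ (fun z : ℂ => z) 0 := analyticAt_id
  have hc : ∀ c : ℂ, AnalyticAt ℂ (fun _ : ℂ => c) 0 := fun c => analyticAt_const
  have h := taylorAtZero_congr (eventually_deriv_deriv_weierstrassPExcept L)
  change taylorAtZero ((fun z => z) * (fun z => z) * deriv (deriv ℘[L - (0 : ℂ)]) +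
      (fun _ => L.g₂ / 2) * ((fun z => z) * (fun z => z))) =
    taylorAtZero ((fun _ => 12) * ℘[L - (0 : ℂ)] + (fun _ => 6) * ((fun z => z) * (fun z => z)) *
      (℘[L - (0 : ℂ)] * ℘[L - (0 : ℂ)])) at h
  rw [taylorAtZero_add ((hi.mul hi).mul hf.deriv.deriv) ((hc _).mul (hi.mul hi)),
    taylorAtZero_mul (hi.mul hi) hf.deriv.deriv, taylorAtZero_mul (hc _) (hi.mul hi),
    taylorAtZero_add ((hc _).mul hf) (((hc _).mul (hi.mul hi)).mul (hf.mul hf)),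
    taylorAtZero_mul (hc _) hf, taylorAtZero_mul ((hc _).mul (hi.mul hi)) (hf.mul hf),
    taylorAtZero_mul (hc _) (hi.mul hi), taylorAtZero_mul hf hf, taylorAtZero_mul hi hi,
    taylorAtZero_const, taylorAtZero_const, taylorAtZero_const, taylorAtZero_id] at h
  linear_combination h

theorem sum_range_eq_sum_even {g : ℕ → ℂ} (hg : ∀ i, Odd i → g i = 0) (k : ℕ) :
    ∑ i ∈ Finset.range (2 * k + 1), g i = ∑ i ∈ Finset.range (k + 1), g (2 * i) := by
  induction k with
  | zero => simp
  | succ k ih =>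
    rw [show 2 * (k + 1) + 1 = (2 * k + 1) + 1 + 1 by ring, Finset.sum_range_succ,
      Finset.sum_range_succ, ih, Finset.sum_range_succ _ (k + 1), hg (2 * k + 1) ⟨k, rfl⟩, add_zero]
    rfl

/-- The cases `1` and `2` come from the Eisenstein sums. The differential equation cannot give the
second: the factor `(2k-4)(2k+3)` vanishes at `k = 2`, which leaves `g₃` free. From `3` on it is the
recursion. -/
theorem coeff_even_taylorAtZero_weierstrassPExcept (m : ℕ) :
    (taylorAtZero ℘[L - (0 : ℂ)]).coeff (2 * m) =
      MvPolynomial.aeval ![L.g₂, L.g₃] (wpPoly m) := by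
  induction m using Nat.strong_induction_on with
  | _ m ih =>
    match m, ih with
    | 0, _ => simpa [wpPoly] using coeff_zero_taylorAtZero_weierstrassPExcept L
    | 1, _ =>
      rw [coeff_taylorAtZero_weierstrassPExcept L _ (by norm_num), wpPoly, map_mul,
        MvPolynomial.aeval_C, MvPolynomial.aeval_X]
      have : algebraMap NNReal ℂ (1 / 20) = 1 / 20 := by
        change (((1 / 20 : NNReal) : ℝ) : ℂ) = _
        push_cast
        rfl
      rw [this]
      simp [g₂]
      ring
    | 2, _ =>
      rw [coeff_taylorAtZero_weierstrassPExcept L _ (by norm_num), wpPoly, map_mul,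
        MvPolynomial.aeval_C, MvPolynomial.aeval_X]
      have : algebraMap NNReal ℂ (1 / 28) = 1 / 28 := by
        change (((1 / 28 : NNReal) : ℝ) : ℂ) = _
        push_cast
        rfl
      rw [this]
      simp [g₃]
      ring
    | (m + 3), ih =>
      have h := congrArg (PowerSeries.coeff (2 * m + 4 + 2)) (taylorAtZero_weierstrassPExcept_ode L)
      rw [map_add, map_add, PowerSeries.coeff_C_mul, PowerSeries.coeff_C_mul,
        PowerSeries.coeff_C_mul, PowerSeries.coeff_X_pow_mul, PowerSeries.coeff_X_pow_mul,
        PowerSeries.coeff_X_pow, if_neg (by omega), coeff_taylorAtZero_deriv,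
        coeff_taylorAtZero_deriv, pow_two, PowerSeries.coeff_mul,
        Finset.Nat.sum_antidiagonal_eq_sum_range_succ_mk, Nat.succ_eq_add_one,
        show 2 * m + 4 = 2 * (m + 2) by ring, sum_range_eq_sum_even] at h
      swap
      · intro i hi
        simp only
        rw [coeff_odd_taylorAtZero_weierstrassPExcept L hi, zero_mul]
      have hs : ∑ i ∈ Finset.range (m + 2 + 1), (taylorAtZero ℘[L - (0 : ℂ)]).coeff (2 * i) *
          (taylorAtZero ℘[L - (0 : ℂ)]).coeff (2 * (m + 2) - 2 * i) =
          ∑ i ∈ Finset.range (m + 3), MvPolynomial.aeval ![L.g₂, L.g₃] (wpPoly i) *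
            MvPolynomial.aeval ![L.g₂, L.g₃] (wpPoly (m + 2 - i)) := by
        refine Finset.sum_congr rfl fun i hi => ?_
        have hi := Finset.mem_range.1 hi
        rw [← Nat.mul_sub, ih i hi, ih (m + 2 - i) (by omega)]
      simp only [] at h
      rw [hs] at h
      rw [wpPoly_succ]
      simp only [map_mul, map_sum]
      rw [MvPolynomial.aeval_C]
      have hc : algebraMap NNReal ℂ (6 / ((2 * m + 2) * (2 * m + 9))) =
          6 / ((2 * m + 2) * (2 * m + 9)) := by
        change (((6 / ((2 * m + 2) * (2 * m + 9)) : NNReal) : ℝ) : ℂ) = _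
        push_cast
        rfl
      have h1 : (2 * (m : ℂ) + 2) ≠ 0 := by exact_mod_cast (by omega : 2 * m + 2 ≠ 0)
      have h2 : (2 * (m : ℂ) + 9) ≠ 0 := by exact_mod_cast (by omega : 2 * m + 9 ≠ 0)
      rw [hc, div_mul_eq_mul_div, eq_div_iff (mul_ne_zero h1 h2)]
      rw [show 2 * (m + 3) = 2 * (m + 2) + 1 + 1 by ring]
      rw [show 2 * (m + 2) + 2 = 2 * (m + 2) + 1 + 1 by ring] at h
      push_cast at h
      linear_combination h

theorem eventually_hasSum_weierstrassPExcept : ∀ᶠ z in 𝓝 0, HasSum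
    (fun m => z ^ (2 * m) * MvPolynomial.aeval ![L.g₂, L.g₃] (wpPoly m)) (℘[L - (0 : ℂ)] z) := by
  filter_upwards [eventually_hasSum_taylorAtZero (analyticAt_weierstrassPExcept_zero L)] with z hz
  have h := ((mul_right_injective₀ (two_ne_zero' ℕ)).hasSum_iff ?_).2 hz
  · refine h.congr_fun fun m => ?_
    simp only [Function.comp_apply, coeff_even_taylorAtZero_weierstrassPExcept]
  · intro n hn
    have : Odd n := by
      rw [← Nat.not_even_iff_odd]
      rintro ⟨k, rfl⟩
      exact hn ⟨k, two_mul k⟩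
    rw [coeff_odd_taylorAtZero_weierstrassPExcept L this, mul_zero]

theorem analyticAt_zetaExcept_zero : AnalyticAt ℂ (zetaExcept L) 0 :=
  analyticOnNhd_zetaExcept L 0 (by simp)

theorem coeff_succ_taylorAtZero_zetaExcept (n : ℕ) :
    (taylorAtZero (zetaExcept L)).coeff (n + 1) * (n + 1) =
      -(taylorAtZero ℘[L - (0 : ℂ)]).coeff n := by
  have h : deriv (zetaExcept L) =ᶠ[𝓝 0] (fun _ => (-1 : ℂ)) * ℘[L - (0 : ℂ)] := by
    filter_upwards [L.compl_lattice_sdiff_singleton_mem_nhds 0] with z hz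
    rw [(hasDerivAt_zetaExcept L hz).deriv]
    simp
  rw [← coeff_taylorAtZero_deriv, taylorAtZero_congr h,
    taylorAtZero_mul analyticAt_const (analyticAt_weierstrassPExcept_zero L), taylorAtZero_const,
    PowerSeries.coeff_C_mul, neg_one_mul]

/-- Termwise integration of the series of `℘`; the weight `-1/(2m+1)` comes from there, and oddness
leaves no constant term. -/
theorem eventually_hasSum_zetaExcept : ∀ᶠ z in 𝓝 0, HasSum
    (fun m : ℕ => z ^ (2 * m + 1) * (-1 / (2 * m + 1) *
      MvPolynomial.aeval ![L.g₂, L.g₃] (wpPoly m))) (zetaExcept L z) := by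
  filter_upwards [eventually_hasSum_taylorAtZero (analyticAt_zetaExcept_zero L)] with z hz
  have hinj : Function.Injective fun m : ℕ => 2 * m + 1 := fun a b h => by
    simpa using h
  have h := (hinj.hasSum_iff ?_).2 hz
  · refine h.congr_fun fun m => ?_
    have h1 := coeff_succ_taylorAtZero_zetaExcept L (2 * m)
    rw [coeff_even_taylorAtZero_weierstrassPExcept] at h1
    have h2 : (2 * (m : ℂ) + 1) ≠ 0 := by exact_mod_cast (by omega : 2 * m + 1 ≠ 0)
    push_cast at h1
    simp only [Function.comp_apply]
    rw [eq_div_of_mul_eq h2 h1]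
    ring
  · intro n hn
    have hn : Even n := by
      rw [← Nat.not_odd_iff_even]
      rintro ⟨k, rfl⟩
      exact hn ⟨k, rfl⟩
    rcases n with _ | n
    · simp [coeff_taylorAtZero, zetaExcept_zero]
    · have h1 := coeff_succ_taylorAtZero_zetaExcept L n
      rw [coeff_odd_taylorAtZero_weierstrassPExcept L (by
        rwa [Nat.even_add_one, Nat.not_even_iff_odd] at hn), neg_zero] at h1
      have h2 : ((n : ℂ) + 1) ≠ 0 := by exact_mod_cast (by omega : n + 1 ≠ 0)
      rw [(mul_eq_zero.1 h1).resolve_right h2, mul_zero]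

end Laurent
end EllipticDer

namespace EllipticDer
open Filter Topology PeriodPair

/-! ### The Weierstrass functions in terms of the universal series -/

section Uniform

/-- `u ^ 2 * ℘(u)` as a function of `(g₂ u ^ 4, g₃ u ^ 6)`. -/
noncomputable def univP (x : ℂ × ℂ) : ℂ := 1 + univSeries (fun _ => 1) x

/-- `u * ζ(u)` as a function of `(g₂ u ^ 4, g₃ u ^ 6)`. -/
noncomputable def univZeta (x : ℂ × ℂ) : ℂ := 1 + univSeries (fun m => -1 / (2 * m + 1)) x

theorem norm_zeta_weight_le (m : ℕ) : ‖(-1 / (2 * m + 1) : ℂ)‖ ≤ 1 := by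
  rw [norm_div, norm_neg, norm_one]
  have : ‖(2 * m + 1 : ℂ)‖ = 2 * m + 1 := by
    have := Complex.norm_natCast (2 * m + 1)
    push_cast at this
    exact this
  rw [this]
  exact div_le_one_of_le₀ (by linarith [(Nat.cast_nonneg m : (0 : ℝ) ≤ m)]) (by positivity)

theorem analyticOnNhd_univP : AnalyticOnNhd ℂ univP (Metric.ball 0 1) :=
  analyticOnNhd_const.add (analyticOnNhd_univSeries fun _ => by simp)

theorem analyticOnNhd_univZeta : AnalyticOnNhd ℂ univZeta (Metric.ball 0 1) :=
  analyticOnNhd_const.add (analyticOnNhd_univSeries norm_zeta_weight_le)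

theorem hasSum_univSeries_scale {r : ℕ → ℂ} (hr : ∀ m, ‖r m‖ ≤ 1) {a b z : ℂ}
    (hz : ‖(a * z ^ 4, b * z ^ 6)‖ < 1) :
    HasSum (fun m => z ^ (2 * m + 2) * (r m * MvPolynomial.aeval ![a, b] (wpPoly m)))
      (univSeries r (a * z ^ 4, b * z ^ 6)) := by
  refine (hasSum_univSeries hr hz).congr_fun fun m => ?_
  rw [aeval_wpPoly_mul]
  ring

/-- The points at which the universal series converges. -/
def scaleDisc (a b : ℂ) : Set ℂ := {z | ‖(a * z ^ 4, b * z ^ 6)‖ < 1}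

variable {a b : ℂ}

theorem isOpen_scaleDisc : IsOpen (scaleDisc a b) :=
  isOpen_lt (by fun_prop) continuous_const

theorem zero_mem_scaleDisc : (0 : ℂ) ∈ scaleDisc a b := by
  simp [scaleDisc]

theorem isPreconnected_scaleDisc : IsPreconnected (scaleDisc a b) := by
  have h : StarConvex ℝ 0 (scaleDisc a b) := by
    refine starConvex_zero_iff.2 fun z hz t h0 h1 => ?_
    refine lt_of_le_of_lt (b := ‖(a * z ^ 4, b * z ^ 6)‖) ?_ hz
    have ht : ∀ n : ℕ, ‖(t : ℂ) ^ n‖ ≤ 1 := fun n => by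
      rw [norm_pow, Complex.norm_real, Real.norm_of_nonneg h0]
      exact pow_le_one₀ h0 h1
    refine max_le_max ?_ ?_
    · simp only [Complex.real_smul, mul_pow, mul_left_comm a, norm_mul ((t : ℂ) ^ 4)]
      exact mul_le_of_le_one_left (norm_nonneg _) (ht 4)
    · simp only [Complex.real_smul, mul_pow, mul_left_comm b, norm_mul ((t : ℂ) ^ 6)]
      exact mul_le_of_le_one_left (norm_nonneg _) (ht 6)
  exact (h.isPathConnected zero_mem_scaleDisc).isConnected.isPreconnected

theorem analyticOnNhd_comp_scale {F : ℂ × ℂ → ℂ} (hF : AnalyticOnNhd ℂ F (Metric.ball 0 1)) :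
    AnalyticOnNhd ℂ (fun z => F (a * z ^ 4, b * z ^ 6)) (scaleDisc a b) := fun z hz =>
  (hF (a * z ^ 4, b * z ^ 6) (mem_ball_zero_iff.2 hz)).comp_of_eq
    ((analyticAt_const.mul (analyticAt_id.pow 4)).prod (analyticAt_const.mul (analyticAt_id.pow 6)))
    rfl

variable (L : PeriodPair)

theorem eventually_univP_eq : ∀ᶠ z in 𝓝 0,
    univP (L.g₂ * z ^ 4, L.g₃ * z ^ 6) = 1 + z ^ 2 * ℘[L - (0 : ℂ)] z := by
  filter_upwards [eventually_hasSum_weierstrassPExcept L,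
    isOpen_scaleDisc.mem_nhds (zero_mem_scaleDisc (a := L.g₂) (b := L.g₃))] with z h hz
  rw [univP, (hasSum_univSeries_scale (by simp) hz).unique]
  refine (h.mul_left (z ^ 2)).congr_fun fun m => ?_
  ring

theorem eventually_univZeta_eq : ∀ᶠ z in 𝓝 0,
    univZeta (L.g₂ * z ^ 4, L.g₃ * z ^ 6) = 1 + z * zetaExcept L z := by
  filter_upwards [eventually_hasSum_zetaExcept L,
    isOpen_scaleDisc.mem_nhds (zero_mem_scaleDisc (a := L.g₂) (b := L.g₃))] with z h hz
  rw [univZeta, (hasSum_univSeries_scale norm_zeta_weight_le hz).unique]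
  refine (h.mul_left z).congr_fun fun m => ?_
  ring

/-- The difference is meromorphic on the connected set `scaleDisc` and vanishes near `0`, so it has
infinite order at every point. The neighbourhood is punctured because poles of `℘` inside are not
excluded yet. -/
theorem eventually_univP_eq_of_mem {z₀ : ℂ} (hz : z₀ ∈ scaleDisc L.g₂ L.g₃) :
    ∀ᶠ z in 𝓝[≠] z₀, univP (L.g₂ * z ^ 4, L.g₃ * z ^ 6) = z ^ 2 * ℘[L] z := by
  set F : ℂ → ℂ := fun z => univP (L.g₂ * z ^ 4, L.g₃ * z ^ 6) - z ^ 2 * ℘[L] z with hF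
  have hm : MeromorphicOn F (scaleDisc L.g₂ L.g₃) := fun z hz =>
    ((analyticOnNhd_comp_scale analyticOnNhd_univP z hz).meromorphicAt).sub
      ((analyticAt_id.pow 2).meromorphicAt.mul (L.meromorphic_weierstrassP z))
  have h0 : meromorphicOrderAt F 0 = ⊤ := by
    rw [meromorphicOrderAt_eq_top_iff]
    filter_upwards [nhdsWithin_le_nhds (eventually_univP_eq L), self_mem_nhdsWithin] with z h hz
    have hz : z ≠ 0 := hz
    rw [hF]
    simp only
    rw [h, weierstrassP_eq]
    field_simp
    ring
  have h1 : meromorphicOrderAt F z₀ = ⊤ := by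
    by_contra h1
    exact hm.meromorphicOrderAt_ne_top_of_isPreconnected isPreconnected_scaleDisc hz
      zero_mem_scaleDisc h1 h0
  filter_upwards [meromorphicOrderAt_eq_top_iff.1 h1] with z h
  exact sub_eq_zero.1 h

/-- At a nonzero period `℘` has a double pole, while the universal series stays finite: multiplied
by `(w - z)²`, the two sides would tend to `z²` and to `0`. -/
theorem notMem_lattice_of_mem_scaleDisc {z : ℂ} (hz : z ∈ scaleDisc L.g₂ L.g₃) (h0 : z ≠ 0) :
    z ∉ L.lattice := by
  intro hl
  have h1 : Tendsto (fun w => (w - z) ^ 2 * univP (L.g₂ * w ^ 4, L.g₃ * w ^ 6)) (𝓝[≠] z) (𝓝 0) := by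
    have hc : ContinuousAt (fun w => (w - z) ^ 2 * univP (L.g₂ * w ^ 4, L.g₃ * w ^ 6)) z := by
      have := (analyticOnNhd_comp_scale analyticOnNhd_univP z hz).continuousAt
      fun_prop
    have := hc.tendsto.mono_left (nhdsWithin_le_nhds (s := {z}ᶜ))
    simpa using this
  have h2 : Tendsto (fun w => w ^ 2 * ((w - z) ^ 2 * ℘[L] (w - z))) (𝓝[≠] z) (𝓝 (z ^ 2 * 1)) := by
    refine Tendsto.mul ((continuous_pow 2).tendsto z |>.mono_left nhdsWithin_le_nhds) ?_
    refine (tendsto_sq_mul_weierstrassP L).comp (tendsto_nhdsWithin_iff.2 ⟨?_, ?_⟩)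
    · have : Tendsto (fun w : ℂ => w - z) (𝓝 z) (𝓝 (z - z)) := (continuous_sub_right z).tendsto z
      rw [sub_self] at this
      exact this.mono_left nhdsWithin_le_nhds
    · filter_upwards [self_mem_nhdsWithin] with w hw
      exact sub_ne_zero.2 hw
  have h3 := tendsto_nhds_unique_of_eventuallyEq h1 h2 (by
    filter_upwards [eventually_univP_eq_of_mem L hz] with w hw
    rw [hw, show ℘[L] (w - z) = ℘[L] w from L.weierstrassP_sub_coe w ⟨z, hl⟩]
    ring)
  exact pow_ne_zero 2 h0 (by simpa using h3.symm)

theorem univP_eq {z : ℂ} (hz : z ∈ scaleDisc L.g₂ L.g₃) (h0 : z ≠ 0) :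
    univP (L.g₂ * z ^ 4, L.g₃ * z ^ 6) = z ^ 2 * ℘[L] z := by
  have h1 := (analyticOnNhd_comp_scale analyticOnNhd_univP z hz)
  have h2 : AnalyticAt ℂ (fun z => z ^ 2 * ℘[L] z) z :=
    (analyticAt_id.pow 2).mul
      (L.analyticOnNhd_weierstrassP z (notMem_lattice_of_mem_scaleDisc L hz h0))
  exact ((h1.frequently_eq_iff_eventually_eq h2).1
    (eventually_univP_eq_of_mem L hz).frequently).self_of_nhds

theorem univZeta_eq {z : ℂ} (hz : z ∈ scaleDisc L.g₂ L.g₃) (h0 : z ≠ 0) :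
    univZeta (L.g₂ * z ^ 4, L.g₃ * z ^ 6) = z * zetaL L z := by
  have h2 : AnalyticOnNhd ℂ (fun z => 1 + z * zetaExcept L z) (scaleDisc L.g₂ L.g₃) := fun w hw =>
    analyticAt_const.add (analyticAt_id.mul (analyticOnNhd_zetaExcept L w fun h =>
      notMem_lattice_of_mem_scaleDisc L hw h.2 h.1))
  have h := (analyticOnNhd_comp_scale analyticOnNhd_univZeta).eqOn_of_preconnected_of_eventuallyEq h2
    isPreconnected_scaleDisc zero_mem_scaleDisc (eventually_univZeta_eq L) hz
  simp only at h
  rw [h, zetaL_eq]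
  field_simp

end Uniform

/-! ### Analyticity in all variables -/

section Joint

/-- The arguments of the universal series. -/
noncomputable def scaleMap (p : E) : ℂ × ℂ := (-4 * p.2.1 * p.1 ^ 4, -4 * p.2.2 * p.1 ^ 6)

/-- The region on which the universal series represent `℘` and `ζ`. -/
def smallSet : Set E := {p | IsNonsingular p.2.1 p.2.2 ∧ p.1 ≠ 0 ∧ ‖scaleMap p‖ < 1}

theorem continuous_scaleMap : Continuous scaleMap := by unfold scaleMap; fun_prop

theorem analyticAt_fst (p : E) : AnalyticAt ℂ (fun q : E => q.1) p := _root_.analyticAt_fst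

theorem analyticAt_snd_fst (p : E) : AnalyticAt ℂ (fun q : E => q.2.1) p :=
  ((ContinuousLinearMap.fst ℂ ℂ ℂ).comp (ContinuousLinearMap.snd ℂ ℂ (ℂ × ℂ))).analyticAt p

theorem analyticAt_snd_snd (p : E) : AnalyticAt ℂ (fun q : E => q.2.2) p :=
  ((ContinuousLinearMap.snd ℂ ℂ ℂ).comp (ContinuousLinearMap.snd ℂ ℂ (ℂ × ℂ))).analyticAt p

theorem analyticAt_scaleMap (p : E) : AnalyticAt ℂ scaleMap p :=
  ((analyticAt_const.mul (analyticAt_snd_fst p)).mul ((analyticAt_fst p).pow 4)).prod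
    ((analyticAt_const.mul (analyticAt_snd_snd p)).mul ((analyticAt_fst p).pow 6))

theorem isOpen_nonsingular : IsOpen {p : E | IsNonsingular p.2.1 p.2.2} :=
  isOpen_ne_fun (by fun_prop) continuous_const

theorem isOpen_smallSet : IsOpen smallSet :=
  isOpen_nonsingular.inter ((isOpen_ne_fun continuous_fst continuous_const).inter
    (isOpen_lt continuous_scaleMap.norm continuous_const))

theorem mem_scaleDisc_periods {p : E} (hp : p ∈ smallSet) :
    p.1 ∈ scaleDisc (periods p.2.1 p.2.2).g₂ (periods p.2.1 p.2.2).g₃ := by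
  obtain ⟨h2, h3⟩ := periods_spec hp.1
  have := hp.2.2
  rw [scaleMap] at this
  rwa [scaleDisc, h2, h3]

theorem smallSet_subset : smallSet ⊆ regSet := fun _ hp =>
  ⟨hp.1, notMem_lattice_of_mem_scaleDisc _ (mem_scaleDisc_periods hp) hp.2.1⟩

theorem wpFun_eq_of_mem_smallSet {p : E} (hp : p ∈ smallSet) :
    wpFun p = univP (scaleMap p) / p.1 ^ 2 := by
  have h := univP_eq _ (mem_scaleDisc_periods hp) hp.2.1
  obtain ⟨h2, h3⟩ := periods_spec hp.1
  rw [h2, h3] at h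
  rw [scaleMap, h, mul_div_cancel_left₀ _ (pow_ne_zero 2 hp.2.1)]
  rfl

theorem zetaFun_eq_of_mem_smallSet {p : E} (hp : p ∈ smallSet) :
    zetaFun p = univZeta (scaleMap p) / p.1 := by
  have h := univZeta_eq _ (mem_scaleDisc_periods hp) hp.2.1
  obtain ⟨h2, h3⟩ := periods_spec hp.1
  rw [h2, h3] at h
  rw [scaleMap, h, mul_div_cancel_left₀ _ hp.2.1]
  rfl

/-- The function `℘'(u; λ)`. -/
noncomputable def wpDerivFun (p : E) : ℂ := (periods p.2.1 p.2.2).derivWeierstrassP p.1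

/-- `℘` and `ζ` are defined and holomorphic near `p`. -/
def GoodAt (p : E) : Prop := regSet ∈ 𝓝 p ∧ AnalyticAt ℂ wpFun p ∧ AnalyticAt ℂ zetaFun p

theorem goodAt_of_mem_smallSet {p : E} (hp : p ∈ smallSet) : GoodAt p := by
  have hn := isOpen_smallSet.mem_nhds hp
  refine ⟨mem_of_superset hn smallSet_subset, ?_, ?_⟩
  · have h : AnalyticAt ℂ (fun p : E => univP (scaleMap p) / p.1 ^ 2) p :=
      ((analyticOnNhd_univP _ (mem_ball_zero_iff.2 hp.2.2)).comp (analyticAt_scaleMap p)).div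
        ((analyticAt_fst p).pow 2) (pow_ne_zero 2 hp.2.1)
    refine h.congr ?_
    filter_upwards [hn] with q hq
    exact (wpFun_eq_of_mem_smallSet hq).symm
  · have h : AnalyticAt ℂ (fun p : E => univZeta (scaleMap p) / p.1) p :=
      ((analyticOnNhd_univZeta _ (mem_ball_zero_iff.2 hp.2.2)).comp (analyticAt_scaleMap p)).div
        (analyticAt_fst p) hp.2.1
    refine h.congr ?_
    filter_upwards [hn] with q hq
    exact (zetaFun_eq_of_mem_smallSet hq).symm

/-- The derivative in `u` of a holomorphic function of three variables. -/
theorem fderiv_fst_eq {F : E → ℂ} {p : E} (hF : AnalyticAt ℂ F p) {d : ℂ}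
    (h : HasDerivAt (fun z => F (z, p.2)) d p.1) : fderiv ℂ F p (1, 0, 0) = d := by
  have h1 : HasDerivAt (fun z : ℂ => ((z, p.2) : E)) (1, 0, 0) p.1 :=
    (hasDerivAt_id p.1).prodMk (hasDerivAt_const p.1 p.2)
  exact (hF.differentiableAt.hasFDerivAt.comp_hasDerivAt p.1 h1).unique h

theorem fderiv_wpFun_eq {p : E} (hr : p ∈ regSet) (h : AnalyticAt ℂ wpFun p) :
    fderiv ℂ wpFun p (1, 0, 0) = wpDerivFun p := by
  have hd := hasDerivAt_weierstrassP (periods p.2.1 p.2.2) hr.2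
  exact fderiv_fst_eq h hd

theorem GoodAt.eventually {p : E} (h : GoodAt p) : ∀ᶠ q in 𝓝 p, GoodAt q := by
  filter_upwards [eventually_mem_nhds_iff.2 h.1, h.2.1.eventually_analyticAt,
    h.2.2.eventually_analyticAt] with q h1 h2 h3
  exact ⟨h1, h2, h3⟩

theorem GoodAt.analyticAt_wpDerivFun {p : E} (h : GoodAt p) : AnalyticAt ℂ wpDerivFun p := by
  have h1 : AnalyticAt ℂ (fun q => fderiv ℂ wpFun q (1, 0, 0)) p :=
    ((ContinuousLinearMap.apply ℂ ℂ ((1, 0, 0) : E)).analyticAt _).comp h.2.1.fderiv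
  refine h1.congr ?_
  filter_upwards [h.eventually] with q hq
  exact fderiv_wpFun_eq (mem_of_mem_nhds hq.1) hq.2.1

/-- The duplication formulas write `℘` and `ζ` at `u` as rational expressions in `℘`, `℘'`, `ζ` at
`u/2` and `λ₄`, whose only denominators are powers of `℘'(u/2)`. -/
theorem GoodAt.two_mul {p : E} (h : GoodAt (p.1 / 2, p.2)) (hp : p ∈ regSet) : GoodAt p := by
  set φ : E → E := fun q => (q.1 / 2, q.2) with hφ
  have hφa : AnalyticAt ℂ φ p :=
    ((analyticAt_fst p).div analyticAt_const two_ne_zero).prod analyticAt_snd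
  have hφc : Tendsto φ (𝓝 p) (𝓝 (φ p)) := hφa.continuousAt
  have hD : wpDerivFun (φ p) ≠ 0 :=
    derivWeierstrassP_ne_zero (L := periods p.2.1 p.2.2) (isRegular_periods hp.1) (by
      change 2 * (p.1 / 2) ∉ _
      rw [mul_div_cancel₀ _ two_ne_zero]
      exact hp.2)
  have hw : AnalyticAt ℂ (wpFun ∘ φ) p := h.2.1.comp_of_eq hφa rfl
  have hz : AnalyticAt ℂ (zetaFun ∘ φ) p := h.2.2.comp_of_eq hφa rfl
  have hd : AnalyticAt ℂ (wpDerivFun ∘ φ) p := h.analyticAt_wpDerivFun.comp_of_eq hφa rfl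
  -- By continuity `℘'` stays nonzero near the halved point, whereas it vanishes at half-periods; so
  -- nearby points also avoid their own lattices.
  have hev : ∀ᶠ q in 𝓝 p, IsNonsingular q.2.1 q.2.2 ∧
      q.1 / 2 ∈ halfCompl (periods q.2.1 q.2.2) := by
    filter_upwards [hφc h.1, hφc.eventually (h.analyticAt_wpDerivFun.continuousAt.eventually_ne hD)]
      with q hq hq'
    have hq : φ q ∈ regSet := hq
    exact ⟨hq.1, fun hl => hq' (derivWeierstrassP_eq_zero_of_two_mul_mem _ hl)⟩
  refine ⟨?_, ?_, ?_⟩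
  · filter_upwards [hev] with q hq
    refine ⟨hq.1, fun hl => hq.2 ?_⟩
    rwa [mul_div_cancel₀ _ two_ne_zero]
  · have ha : AnalyticAt ℂ (fun q => (6 * (wpFun ∘ φ) q ^ 2 + 2 * q.2.1) ^ 2 /
        (4 * (wpDerivFun ∘ φ) q ^ 2) - 2 * (wpFun ∘ φ) q) p :=
      ((((analyticAt_const.mul (hw.pow 2)).add
        (analyticAt_const.mul (analyticAt_snd_fst p))).pow 2).div
          (analyticAt_const.mul (hd.pow 2)) (mul_ne_zero (by norm_num) (pow_ne_zero 2 hD))).sub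
        (analyticAt_const.mul hw)
    refine ha.congr ?_
    filter_upwards [hev] with q hq
    have h1 := weierstrassP_two_mul (isRegular_periods hq.1) hq.2
    rw [mul_div_cancel₀ _ two_ne_zero, dupP, (periods_spec hq.1).1] at h1
    rw [wpFun, h1]
    simp only [Function.comp_apply, wpFun, wpDerivFun, hφ]
    ring
  · have ha : AnalyticAt ℂ (fun q => 2 * (zetaFun ∘ φ) q + (6 * (wpFun ∘ φ) q ^ 2 + 2 * q.2.1) /
        (2 * (wpDerivFun ∘ φ) q)) p :=
      (analyticAt_const.mul hz).add (((analyticAt_const.mul (hw.pow 2)).add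
        (analyticAt_const.mul (analyticAt_snd_fst p))).div
          (analyticAt_const.mul hd) (mul_ne_zero two_ne_zero hD))
    refine ha.congr ?_
    filter_upwards [hev] with q hq
    have h1 := zetaL_two_mul (isRegular_periods hq.1) hq.2
    rw [mul_div_cancel₀ _ two_ne_zero, (periods_spec hq.1).1] at h1
    rw [zetaFun, h1]
    simp only [Function.comp_apply, wpFun, zetaFun, wpDerivFun, hφ]
    ring

/-- Halving `u` often enough brings the point into `smallSet`, where the universal series apply;
doubling returns to `u`, all intermediate points being in `regSet`. -/
theorem goodAt_of_mem_regSet {p : E} (hp : p ∈ regSet) : GoodAt p := by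
  have hreg : ∀ n : ℕ, ((p.1 / 2 ^ n, p.2) : E) ∈ regSet := fun n =>
    ⟨hp.1, fun h => hp.2 (by
      have := Submodule.smul_mem (periods p.2.1 p.2.2).lattice (2 ^ n : ℤ) h
      simp only [zsmul_eq_mul] at this
      push_cast at this
      rwa [mul_div_cancel₀ _ (pow_ne_zero n two_ne_zero)] at this)⟩
  have h0 : p.1 ≠ 0 := by
    intro h
    exact hp.2 (h ▸ zero_mem _)
  have hlim : Tendsto (fun n : ℕ => ((p.1 / 2 ^ n, p.2) : E)) atTop (𝓝 (0, p.2)) := by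
    refine Tendsto.prodMk_nhds ?_ tendsto_const_nhds
    have := (tendsto_pow_atTop_nhds_zero_of_norm_lt_one (x := (1 / 2 : ℂ)) (by
      rw [norm_div, norm_one, Complex.norm_ofNat]; norm_num)).const_mul p.1
    rw [mul_zero] at this
    refine this.congr fun n => ?_
    rw [div_pow, one_pow]
    ring
  have hs : ∀ᶠ n : ℕ in atTop, ‖scaleMap (p.1 / 2 ^ n, p.2)‖ < 1 := by
    have := (continuous_scaleMap.norm.tendsto (0, p.2)).comp hlim
    refine this.eventually_lt_const ?_
    simp [scaleMap]
  obtain ⟨n, hn⟩ := hs.exists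
  have hgood : GoodAt (p.1 / 2 ^ n, p.2) :=
    goodAt_of_mem_smallSet ⟨hp.1, div_ne_zero h0 (pow_ne_zero n two_ne_zero), hn⟩
  clear hn
  induction n with
  | zero => simpa using hgood
  | succ n ih =>
    refine ih (GoodAt.two_mul (p := (p.1 / 2 ^ n, p.2)) ?_ (hreg n))
    rwa [pow_succ, ← div_div] at hgood

theorem isOpen_regSet : IsOpen regSet :=
  isOpen_iff_mem_nhds.2 fun _ hp => (goodAt_of_mem_regSet hp).1

theorem analyticOnNhd_wpFun : AnalyticOnNhd ℂ wpFun regSet := fun _ hp =>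
  (goodAt_of_mem_regSet hp).2.1

theorem analyticOnNhd_zetaFun : AnalyticOnNhd ℂ zetaFun regSet := fun _ hp =>
  (goodAt_of_mem_regSet hp).2.2

theorem coe_X : (X : Set E) = regSet := isOpen_regSet.interior_eq

end Joint
end EllipticDer

namespace EllipticDer
open Filter Topology PeriodPair

/-! ### The algebra of holomorphic functions -/

section Functions

theorem Holo.ext {U : Opens E} {f g : Holo U} (h : ∀ p, f.1 p = g.1 p) : f = g :=
  Subtype.ext (funext h)

theorem partialD_apply_of_rep {U : Opens E} (e : E) {f : Holo U} {F : E → ℂ}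
    (h : ∀ p : U, f.1 p = F p) (p : U) : (partialD U e f).1 p = fderiv ℂ F p e := by
  change fderiv ℂ (ext0 f.1) p e = _
  rw [(ext0_eventuallyEq h p.2).fderiv_eq]

theorem partialD_comm (U : Opens E) (e e' : E) (f : Holo U) :
    partialD U e (partialD U e' f) = partialD U e' (partialD U e f) := by
  obtain ⟨F, hF, hf⟩ := f.2
  have key : ∀ v w : E, ∀ p : U, (partialD U v (partialD U w f)).1 p =
      fderiv ℂ (fderiv ℂ F) p v w := fun v w p => by
    rw [partialD_apply_of_rep v (F := fun q => fderiv ℂ F q w) (partialD_apply_of_rep w hf)]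
    have hd := (hF p p.2).fderiv.differentiableAt
    rw [fderiv_clm_apply hd (differentiableAt_const w)]
    simp
  refine Holo.ext fun p => ?_
  rw [key, key]
  exact ((hF p p.2).contDiffAt.isSymmSndFDerivAt_of_omega).eq e e'

theorem du_d4 (f : O) : du (d4 f) = d4 (du f) := partialD_comm _ _ _ f
theorem du_d6 (f : O) : du (d6 f) = d6 (du f) := partialD_comm _ _ _ f
theorem d4_d6 (f : O) : d4 (d6 f) = d6 (d4 f) := partialD_comm _ _ _ f

theorem mem_regSet (p : X) : (p : E) ∈ regSet := by
  have := p.2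
  rwa [← SetLike.mem_coe, coe_X] at this

theorem mem_X {p : E} (hp : p ∈ regSet) : p ∈ X := by
  rwa [← SetLike.mem_coe, coe_X]

theorem restr_apply {F : E → ℂ} (h : AnalyticOnNhd ℂ F regSet) (p : X) : (restr F).1 p = F p := by
  have h' : AnalyticOnNhd ℂ F X := by rwa [coe_X]
  rw [restr, dif_pos h']

theorem partialD_restr_apply (e : E) {F : E → ℂ} (h : AnalyticOnNhd ℂ F regSet) (p : X) :
    (partialD X e (restr F)).1 p = fderiv ℂ F p e :=
  partialD_apply_of_rep e (restr_apply h) p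

theorem partialD_restr_clm (e : E) (ℓ : E →L[ℂ] ℂ) (c : ℂ) (hc : ℓ e = c) :
    partialD X e (restr fun p => ℓ p) = algebraMap ℂ O c := by
  refine Holo.ext fun p => ?_
  rw [partialD_restr_apply e (fun p _ => ℓ.analyticAt p), ℓ.fderiv, hc]
  rfl

theorem partialD_u (e : E) : partialD X e u = algebraMap ℂ O e.1 :=
  partialD_restr_clm e (ContinuousLinearMap.fst ℂ ℂ (ℂ × ℂ)) _ rfl

theorem partialD_lam4 (e : E) : partialD X e lam4 = algebraMap ℂ O e.2.1 :=
  partialD_restr_clm e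
    ((ContinuousLinearMap.fst ℂ ℂ ℂ).comp (ContinuousLinearMap.snd ℂ ℂ (ℂ × ℂ))) _ rfl

theorem partialD_lam6 (e : E) : partialD X e lam6 = algebraMap ℂ O e.2.2 :=
  partialD_restr_clm e
    ((ContinuousLinearMap.snd ℂ ℂ ℂ).comp (ContinuousLinearMap.snd ℂ ℂ (ℂ × ℂ))) _ rfl

@[simp] theorem du_u : du u = 1 := (partialD_u _).trans (map_one _)
@[simp] theorem d4_u : d4 u = 0 := (partialD_u _).trans (map_zero _)
@[simp] theorem d6_u : d6 u = 0 := (partialD_u _).trans (map_zero _)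
@[simp] theorem du_lam4 : du lam4 = 0 := (partialD_lam4 _).trans (map_zero _)
@[simp] theorem d4_lam4 : d4 lam4 = 1 := (partialD_lam4 _).trans (map_one _)
@[simp] theorem d6_lam4 : d6 lam4 = 0 := (partialD_lam4 _).trans (map_zero _)
@[simp] theorem du_lam6 : du lam6 = 0 := (partialD_lam6 _).trans (map_zero _)
@[simp] theorem d4_lam6 : d4 lam6 = 0 := (partialD_lam6 _).trans (map_zero _)
@[simp] theorem d6_lam6 : d6 lam6 = 1 := (partialD_lam6 _).trans (map_one _)

theorem u_apply (p : X) : u.1 p = p.1.1 := restr_apply (fun p _ => analyticAt_fst p) p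
theorem lam4_apply (p : X) : lam4.1 p = p.1.2.1 := restr_apply (fun p _ => analyticAt_snd_fst p) p
theorem lam6_apply (p : X) : lam6.1 p = p.1.2.2 := restr_apply (fun p _ => analyticAt_snd_snd p) p
theorem wp_apply (p : X) : wp.1 p = wpFun p := restr_apply analyticOnNhd_wpFun p
theorem zeta_apply (p : X) : zeta.1 p = zetaFun p := restr_apply analyticOnNhd_zetaFun p

theorem du_wp_apply (p : X) : (du wp).1 p = wpDerivFun p :=
  (partialD_restr_apply _ analyticOnNhd_wpFun p).trans
    (fderiv_wpFun_eq (mem_regSet p) (analyticOnNhd_wpFun p (mem_regSet p)))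

theorem du_zeta : du zeta = -wp := by
  refine Holo.ext fun p => ?_
  have hd := hasDerivAt_zetaL (periods p.1.2.1 p.1.2.2) (mem_regSet p).2
  refine (partialD_restr_apply _ analyticOnNhd_zetaFun p).trans
    ((fderiv_fst_eq (analyticOnNhd_zetaFun p (mem_regSet p)) hd).trans ?_)
  change _ = -wp.1 p
  rw [wp_apply]
  rfl

theorem du_du_wp : du (du wp) = 6 * wp ^ 2 + 2 * lam4 := by
  refine Holo.ext fun p => ?_
  have hd := hasDerivAt_derivWeierstrassP (periods p.1.2.1 p.1.2.2) (mem_regSet p).2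
  have ha := (goodAt_of_mem_regSet (mem_regSet p)).analyticAt_wpDerivFun
  refine (partialD_apply_of_rep _ du_wp_apply p).trans ((fderiv_fst_eq ha hd).trans ?_)
  change _ = 6 * wp.1 p ^ 2 + 2 * lam4.1 p
  rw [wp_apply, lam4_apply, (periods_spec (mem_regSet p).1).1, wpFun]
  ring

theorem du_wp_sq : du wp ^ 2 = 4 * wp ^ 3 + 4 * lam4 * wp + 4 * lam6 := by
  refine Holo.ext fun p => ?_
  change (du wp).1 p ^ 2 = 4 * wp.1 p ^ 3 + 4 * lam4.1 p * wp.1 p + 4 * lam6.1 p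
  have h := derivWeierstrassP_sq (periods p.1.2.1 p.1.2.2) _ (mem_regSet p).2
  obtain ⟨h2, h3⟩ := periods_spec (mem_regSet p).1
  rw [h2, h3] at h
  rw [du_wp_apply, wp_apply, lam4_apply, lam6_apply, wpDerivFun, h, wpFun]
  ring

/-- Every point `(x, y)` of every curve is a value of `(℘, ℘')`. -/
theorem exists_point {a b x y : ℂ} (hab : IsNonsingular a b)
    (h : y ^ 2 = 4 * x ^ 3 + 4 * a * x + 4 * b) :
    ∃ p : X, wp.1 p = x ∧ (du wp).1 p = y ∧ lam4.1 p = a ∧ lam6.1 p = b := by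
  obtain ⟨h2, h3⟩ := periods_spec hab
  obtain ⟨z, hz, hx, hy⟩ := exists_weierstrassP_eq (L := periods a b) x y (by
    rw [h2, h3, h]; ring)
  refine ⟨⟨(z, a, b), mem_X ⟨hab, hz⟩⟩, ?_, ?_, ?_, ?_⟩
  · rw [wp_apply]; exact hx
  · rw [du_wp_apply]; exact hy
  · rw [lam4_apply]
  · rw [lam6_apply]

theorem disc_apply_ne_zero (p : X) : 4 * lam4.1 p ^ 3 + 27 * lam6.1 p ^ 2 ≠ 0 := by
  rw [lam4_apply, lam6_apply]
  exact (mem_regSet p).1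

/-- A common zero of `℘'` and `℘''` would be a multiple root of the cubic. The zeros of `℘'` are
therefore simple. -/
theorem du_du_wp_apply_ne_zero (p : X) (h : (du wp).1 p = 0) : (du (du wp)).1 p ≠ 0 := by
  have h1 : (du (du wp)).1 p = 6 * wp.1 p ^ 2 + 2 * lam4.1 p := by rw [du_du_wp]; rfl
  have h2 : (du wp).1 p ^ 2 = 4 * wp.1 p ^ 3 + 4 * lam4.1 p * wp.1 p + 4 * lam6.1 p := by
    have := congrArg (fun f : O => f.1 p) du_wp_sq
    exact this
  rw [h] at h2
  rw [h1]
  intro h3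
  apply disc_apply_ne_zero p
  have h4 : lam4.1 p = -3 * wp.1 p ^ 2 := by linear_combination h3 / 2
  have h6 : lam6.1 p = 2 * wp.1 p ^ 3 := by rw [h4] at h2; linear_combination -h2 / 4
  rw [h4, h6]
  ring

/-- Where `γ ≠ 0` one has `℘' = 0`, and the differentiated relation then gives `γ℘'' = 0`,
impossible at a simple zero. This cancels `℘'` without any connectedness of `X`. -/
theorem eq_zero_of_mul_du_wp {γ : O} (h : γ * du wp = 0) : γ = 0 := by
  have h1 := congrArg du h
  rw [map_zero, Derivation.leibniz, smul_eq_mul, smul_eq_mul] at h1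
  refine Holo.ext fun p => ?_
  change γ.1 p = 0
  by_contra hp
  have h0 : γ.1 p * (du wp).1 p = 0 := congrArg (fun f : O => f.1 p) h
  have h2 := (mul_eq_zero.1 h0).resolve_left hp
  have h3 : γ.1 p * (du (du wp)).1 p + (du wp).1 p * (du γ).1 p = 0 :=
    congrArg (fun f : O => f.1 p) h1
  rw [h2, zero_mul, add_zero] at h3
  exact du_du_wp_apply_ne_zero p h2 ((mul_eq_zero.1 h3).resolve_left hp)

theorem eq_zero_of_mul_lam4 {γ : O} (h : γ * lam4 = 0) : γ = 0 := by
  have h1 := congrArg d4 h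
  rw [map_zero, Derivation.leibniz, smul_eq_mul, smul_eq_mul, d4_lam4] at h1
  have h2 : γ * γ = 0 := by linear_combination γ * h1 - d4 γ * h
  refine Holo.ext fun p => ?_
  have h0 : γ.1 p * γ.1 p = 0 := congrArg (fun f : O => f.1 p) h2
  exact mul_self_eq_zero.1 h0

end Functions

/-! ### A uniqueness principle -/

section Uniqueness

/-- The restriction of a holomorphic function to the curve with parameters `l`. -/
noncomputable def slice (h : O) (l : ℂ × ℂ) (z : ℂ) : ℂ := ext0 h.1 (z, l)

theorem slice_apply (h : O) {l : ℂ × ℂ} {z : ℂ} (hz : (z, l) ∈ X) :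
    slice h l z = h.1 ⟨(z, l), hz⟩ := Subtype.val_injective.extend_apply h.1 0 ⟨(z, l), hz⟩

theorem hasDerivAt_slice (h : O) {l : ℂ × ℂ} {z : ℂ} (hz : (z, l) ∈ X) :
    HasDerivAt (slice h l) (slice (du h) l z) z := by
  rw [slice_apply _ hz]
  have h1 : HasDerivAt (fun z : ℂ => ((z, l) : E)) (1, 0, 0) z :=
    (hasDerivAt_id z).prodMk (hasDerivAt_const z l)
  exact (ext0_differentiableAt h ⟨(z, l), hz⟩).hasFDerivAt.comp_hasDerivAt z h1

theorem slice_wp {a b z : ℂ} (hz : (z, a, b) ∈ X) : slice wp (a, b) z = ℘[periods a b] z := by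
  rw [slice_apply _ hz, wp_apply]
  rfl

theorem slice_du_wp {a b z : ℂ} (hz : (z, a, b) ∈ X) :
    slice (du wp) (a, b) z = ℘'[periods a b] z := by
  rw [slice_apply _ hz, du_wp_apply]
  rfl

theorem slice_zeta {a b z : ℂ} (hz : (z, a, b) ∈ X) :
    slice zeta (a, b) z = zetaL (periods a b) z := by
  rw [slice_apply _ hz, zeta_apply]
  rfl

/-- A solution of `h' ℘' = ℘'' h` is a multiple of `℘'` on each curve, so it vanishes if its poles
at the lattice points are of order less than three. -/
theorem eq_zero_of_du_mul_eq {h : O} (hode : du h * du wp = du (du wp) * h)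
    (hlim : ∀ a b, IsNonsingular a b →
      Tendsto (fun z => z ^ 3 * slice h (a, b) z) (𝓝[≠] 0) (𝓝 0)) : h = 0 := by
  refine Holo.ext fun ⟨⟨z, a, b⟩, hp⟩ => ?_
  obtain ⟨hab, hz⟩ := mem_regSet ⟨(z, a, b), hp⟩
  simp only at hab hz
  rw [← slice_apply h hp]
  change slice h (a, b) z = 0
  set L := periods a b with hL
  have hX : ∀ w ∉ L.lattice, (w, a, b) ∈ X := fun w hw => mem_X ⟨hab, hw⟩
  have han : ∀ f : O, AnalyticOnNhd ℂ (slice f (a, b)) (L.lattice : Set ℂ)ᶜ := fun f =>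
    DifferentiableOn.analyticOnNhd (fun w hw =>
      (hasDerivAt_slice f (hX w hw)).differentiableAt.differentiableWithinAt)
      (isOpen_compl_lattice L)
  -- The equation says that `h/℘'` has derivative zero where `℘'` does not vanish.
  have hquot : ∀ w ∈ halfCompl L,
      HasDerivAt (fun w => slice h (a, b) w / slice (du wp) (a, b) w) 0 w := fun w hw => by
    have hwL := notMem_of_mem_halfCompl L hw
    have hwX := hX w hwL
    have hne : slice (du wp) (a, b) w ≠ 0 := by
      rw [slice_du_wp hwX]
      exact derivWeierstrassP_ne_zero (isRegular_periods hab) hw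
    refine ((hasDerivAt_slice h hwX).div (hasDerivAt_slice (du wp) hwX) hne).congr_deriv ?_
    have h1 : (du h).1 ⟨_, hwX⟩ * (du wp).1 ⟨_, hwX⟩ = (du (du wp)).1 ⟨_, hwX⟩ * h.1 ⟨_, hwX⟩ :=
      congrArg (fun f : O => f.1 ⟨_, hwX⟩) hode
    rw [slice_apply _ hwX, slice_apply _ hwX, slice_apply _ hwX, slice_apply _ hwX, h1, mul_comm,
      sub_self, zero_div]
  obtain ⟨c, hc⟩ := (isOpen_halfCompl L).exists_is_const_of_deriv_eq_zero
    (isPreconnected_halfCompl L)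
    (fun w hw => (hquot w hw).differentiableAt.differentiableWithinAt)
    (fun w hw => (hquot w hw).deriv)
  have hc' : ∀ w ∈ halfCompl L, slice h (a, b) w = c * slice (du wp) (a, b) w := fun w hw => by
    rw [← hc w hw, div_mul_cancel₀]
    rw [slice_du_wp (hX w (notMem_of_mem_halfCompl L hw))]
    exact derivWeierstrassP_ne_zero (isRegular_periods hab) hw
  -- `z³℘'` tends to `-2`, so the assumed limit `0` gives `-2c = 0`.
  have hc0 : c = 0 := by
    have h1 := (tendsto_cube_mul_derivWeierstrassP L).const_mul c
    have h2 := tendsto_nhds_unique_of_eventuallyEq h1 (hlim a b hab) (by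
      filter_upwards [eventually_mem_halfCompl L] with w hw
      rw [hc' w hw, slice_du_wp (hX w (notMem_of_mem_halfCompl L hw))]
      ring)
    simpa using h2
  obtain ⟨w, hw⟩ := (eventually_mem_halfCompl L).exists
  refine (han h).eqOn_zero_of_preconnected_of_eventuallyEq_zero (isPreconnected_compl_lattice L)
    (notMem_of_mem_halfCompl L hw) ?_ hz
  filter_upwards [(isOpen_halfCompl L).mem_nhds hw] with v hv
  rw [hc' v hv, hc0, zero_mul]
  rfl

end Uniqueness
end EllipticDer

namespace EllipticDer
open Filter Topology PeriodPair

/-! ### The action of the operators on the Weierstrass functions -/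

section Limits

variable {a b : ℂ}

theorem eventually_mem_smallSet (hab : IsNonsingular a b) :
    ∀ᶠ z in 𝓝[≠] (0 : ℂ), ((z, a, b) : E) ∈ smallSet := by
  have hs : ∀ᶠ z : ℂ in 𝓝 0, ‖scaleMap (z, a, b)‖ < 1 := by
    have hc : Continuous fun z : ℂ => ‖scaleMap (z, a, b)‖ :=
      (continuous_scaleMap.comp (by fun_prop : Continuous fun z : ℂ => ((z, a, b) : E))).norm
    refine (hc.tendsto 0).eventually_lt_const ?_
    simp [scaleMap]
  filter_upwards [nhdsWithin_le_nhds hs, self_mem_nhdsWithin] with z h h0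
  exact ⟨hab, h0, h⟩

/-- The derivatives of `℘` in the parameters have poles of order at most two. -/
theorem tendsto_slice_partialD_wp (hab : IsNonsingular a b) (v : ℂ × ℂ) :
    Tendsto (fun z => z ^ 3 * slice (partialD X (0, v) wp) (a, b) z) (𝓝[≠] 0) (𝓝 0) := by
  set F : E → ℂ := fun p => univP (scaleMap p) with hF
  have hFa : ∀ p : E, ‖scaleMap p‖ < 1 → AnalyticAt ℂ F p := fun p hp =>
    (analyticOnNhd_univP _ (mem_ball_zero_iff.2 hp)).comp (analyticAt_scaleMap p)
  have hc : ContinuousAt (fun z : ℂ => z * fderiv ℂ F (z, a, b) (0, v)) 0 := by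
    refine continuousAt_id.mul ?_
    have h1 : ContinuousAt (fderiv ℂ F) ((0 : ℂ), a, b) :=
      (hFa _ (by simp [scaleMap])).fderiv.continuousAt
    have h2 : ContinuousAt (fun z : ℂ => fderiv ℂ F (z, a, b)) 0 :=
      ContinuousAt.comp' (f := fun z : ℂ => ((z, a, b) : E)) h1 (by fun_prop)
    exact h2.clm_apply continuousAt_const
  have hl := hc.tendsto.mono_left (nhdsWithin_le_nhds (s := {0}ᶜ))
  rw [zero_mul] at hl
  refine hl.congr' ?_
  filter_upwards [eventually_mem_smallSet hab] with z hz
  have hzX : (z, a, b) ∈ X := mem_X (smallSet_subset hz)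
  rw [slice_apply _ hzX, wp, partialD_restr_apply _ analyticOnNhd_wpFun]
  -- A derivative in the parameters does not see `u²`, so `u³ ∂_v ℘ = u ∂_v F`, with `F = u²℘`
  -- analytic at `u = 0` as well.
  have hev : F =ᶠ[𝓝 (z, a, b)] fun p => wpFun p * p.1 ^ 2 := by
    filter_upwards [isOpen_smallSet.mem_nhds hz] with p hp
    rw [wpFun_eq_of_mem_smallSet hp, div_mul_cancel₀ _ (pow_ne_zero 2 hp.2.1)]
  have hd := (analyticOnNhd_wpFun _ (smallSet_subset hz)).differentiableAt.hasFDerivAt.mul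
    ((hasFDerivAt_fst (𝕜 := ℂ) (p := ((z, a, b) : E))).pow 2)
  rw [(hd.congr_of_eventuallyEq hev).fderiv]
  simp
  ring


end Limits

section Actions

@[simp] theorem derivation_ofNat (D : Derivation ℂ O O) (n : ℕ) [n.AtLeastTwo] :
    D ofNat(n) = 0 := by
  change D (OfNat.ofNat n) = 0
  rw [← Nat.cast_ofNat, D.map_natCast]

theorem two_mul_cancel {f g : O} (h : 2 * f = 2 * g) : f = g := by
  refine Holo.ext fun p => ?_
  have h1 : 2 * f.1 p = 2 * g.1 p := congrArg (fun f : O => f.1 p) h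
  exact mul_left_cancel₀ two_ne_zero h1

/-- The constant function `1 / 3`. -/
noncomputable def third : O := algebraMap ℂ O (1 / 3)

theorem three_mul_third : 3 * third = 1 := by
  rw [third, ← map_ofNat (algebraMap ℂ O) 3, ← map_mul]
  norm_num

theorem smul_eq_third (n : ℕ) [n.AtLeastTwo] (f : O) :
    ((OfNat.ofNat n / 3 : ℂ)) • f = OfNat.ofNat n * third * f := by
  rw [Algebra.smul_def, third, ← map_ofNat (algebraMap ℂ O) n, ← map_mul]
  congr 2
  ring

@[simp] theorem derivation_third (D : Derivation ℂ O O) : D third = 0 := D.map_algebraMap _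

theorem ell0_apply (f : O) : ell0 f = 4 * lam4 * d4 f + 6 * lam6 * d6 f := rfl

theorem ell2_apply (f : O) : ell2 f = 6 * lam6 * d4 f - 4 * third * lam4 ^ 2 * d6 f := by
  rw [← smul_eq_third]
  rfl

theorem L0_apply (f : O) : L0 f = 4 * lam4 * d4 f + 6 * lam6 * d6 f - u * du f := rfl

theorem L1_apply (f : O) : L1 f = du f := rfl

theorem L2_apply (f : O) : L2 f = 6 * lam6 * d4 f - 4 * third * lam4 ^ 2 * d6 f - zeta * du f := by
  rw [← smul_eq_third]
  rfl

theorem du_ell0 (f : O) : du (ell0 f) = ell0 (du f) := by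
  simp only [ell0_apply, map_add, Derivation.leibniz, smul_eq_mul, du_d4, du_d6, du_lam4, du_lam6,
    derivation_ofNat]
  ring

theorem du_ell2 (f : O) : du (ell2 f) = ell2 (du f) := by
  simp only [ell2_apply, map_sub, Derivation.leibniz, Derivation.leibniz_pow, smul_eq_mul, du_d4,
    du_d6, du_lam4, du_lam6, derivation_ofNat, derivation_third]
  ring

theorem L0_du (f : O) : L0 (du f) = du (L0 f) + du f := by
  change ell0 (du f) - u * du (du f) = du (ell0 f - u * du f) + du f
  rw [map_sub, du_ell0, Derivation.leibniz, du_u, smul_eq_mul, smul_eq_mul]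
  ring

theorem L2_du (f : O) : L2 (du f) = du (L2 f) - wp * du f := by
  change ell2 (du f) - zeta * du (du f) = du (ell2 f - zeta * du f) - wp * du f
  rw [map_sub, du_ell2, Derivation.leibniz, du_zeta, smul_eq_mul, smul_eq_mul]
  ring

@[simp] theorem L0_lam4 : L0 lam4 = 4 * lam4 := by simp [L0_apply]
@[simp] theorem L0_lam6 : L0 lam6 = 6 * lam6 := by simp [L0_apply]
@[simp] theorem L2_lam4 : L2 lam4 = 6 * lam6 := by simp [L2_apply]
@[simp] theorem L2_lam6 : L2 lam6 = -(4 * third * lam4 ^ 2) := by simp [L2_apply]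

theorem tendsto_except_zero (L : PeriodPair) :
    Tendsto (fun z => z ^ 3 * (-(z * ℘'[L] z) - 2 * ℘[L] z)) (𝓝[≠] 0) (𝓝 0) := by
  have hf := (L.analyticAt_weierstrassPExcept 0).continuousAt
  have hf' := (L.analyticAt_derivWeierstrassPExcept 0).continuousAt
  have hc : ContinuousAt (fun z => z ^ 3 * (-(z * ℘'[L - (0 : ℂ)] z) - 2 * ℘[L - (0 : ℂ)] z)) 0 := by
    fun_prop
  have hl := hc.tendsto.mono_left (nhdsWithin_le_nhds (s := {0}ᶜ))
  simp only [ne_eq, OfNat.ofNat_ne_zero, not_false_eq_true, zero_pow, zero_mul] at hl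
  refine hl.congr' ?_
  filter_upwards [self_mem_nhdsWithin] with z hz
  have hz : z ≠ 0 := hz
  rw [weierstrassP_eq, derivWeierstrassP_eq]
  field_simp
  ring

/-- The fourth-order poles of `-ζ℘'`, `-(2/3)℘''` and `2℘²` have coefficients `2`, `-4`, `2` and
cancel. This is what singles out the combination in `L2_wp`. -/
theorem tendsto_except_two (L : PeriodPair) :
    Tendsto (fun z => z ^ 3 * (-(zetaL L z * ℘'[L] z) - 2 / 3 * (6 * ℘[L] z ^ 2 - L.g₂ / 2) +
      2 * ℘[L] z ^ 2)) (𝓝[≠] 0) (𝓝 0) := by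
  have hf := (L.analyticAt_weierstrassPExcept 0).continuousAt
  have hf' := (L.analyticAt_derivWeierstrassPExcept 0).continuousAt
  have hg := (analyticAt_zetaExcept_zero L).continuousAt
  have hc : ContinuousAt (fun z => -z ^ 2 * ℘'[L - (0 : ℂ)] z + 2 * zetaExcept L z -
      z ^ 3 * zetaExcept L z * ℘'[L - (0 : ℂ)] z - 4 * z * ℘[L - (0 : ℂ)] z -
      2 * z ^ 3 * ℘[L - (0 : ℂ)] z ^ 2 + z ^ 3 * L.g₂ / 3) 0 := by
    fun_prop
  have hl := hc.tendsto.mono_left (nhdsWithin_le_nhds (s := {0}ᶜ))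
  have h0 : -(0 : ℂ) ^ 2 * ℘'[L - (0 : ℂ)] 0 + 2 * zetaExcept L 0 -
      0 ^ 3 * zetaExcept L 0 * ℘'[L - (0 : ℂ)] 0 - 4 * 0 * ℘[L - (0 : ℂ)] 0 -
      2 * 0 ^ 3 * ℘[L - (0 : ℂ)] 0 ^ 2 + 0 ^ 3 * L.g₂ / 3 = 0 := by
    rw [zetaExcept_zero]
    ring
  rw [h0] at hl
  refine hl.congr' ?_
  filter_upwards [self_mem_nhdsWithin] with z hz
  have hz : z ≠ 0 := hz
  rw [weierstrassP_eq, derivWeierstrassP_eq, zetaL_eq]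
  field_simp
  ring

/-- Applying `L0` to the curve equation, with the commutation rule `L0_du`, gives `h'℘' = ℘''h` for
`h = L0 ℘ - 2℘`; the pole bounds then force `h = 0`. -/
theorem L0_wp : L0 wp = 2 * wp := by
  refine sub_eq_zero.1 (eq_zero_of_du_mul_eq ?_ fun a b hab => ?_)
  · have h1 := congrArg L0 du_wp_sq
    simp only [map_add, Derivation.leibniz, Derivation.leibniz_pow, smul_eq_mul, nsmul_eq_mul,
      L0_lam4, L0_lam6, L0_du, derivation_ofNat, Nat.add_one_sub_one, pow_one] at h1
    push_cast at h1
    simp only [map_sub, Derivation.leibniz, derivation_ofNat, smul_eq_mul]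
    rw [du_du_wp]
    have h2 : (2 : O) * ((du (L0 wp) - (2 * du wp + wp * 0)) * du wp -
      (6 * wp ^ 2 + 2 * lam4) * (L0 wp - 2 * wp)) = 2 * 0 := by
      linear_combination h1 - 6 * du_wp_sq
    have h3 := two_mul_cancel h2
    linear_combination h3
  · have h4 := (tendsto_slice_partialD_wp hab (1, 0)).const_mul (4 * a)
    have h6 := (tendsto_slice_partialD_wp hab (0, 1)).const_mul (6 * b)
    have h := (h4.add h6).add (tendsto_except_zero (periods a b))
    simp only [mul_zero, add_zero] at h
    refine h.congr' ?_
    filter_upwards [eventually_mem_smallSet hab] with z hz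
    have hzX : (z, a, b) ∈ X := mem_X (smallSet_subset hz)
    rw [← slice_wp hzX, ← slice_du_wp hzX]
    simp only [slice_apply _ hzX]
    change _ = z ^ 3 * (4 * lam4.1 ⟨_, hzX⟩ * (d4 wp).1 ⟨_, hzX⟩ +
      6 * lam6.1 ⟨_, hzX⟩ * (d6 wp).1 ⟨_, hzX⟩ - u.1 ⟨_, hzX⟩ * (du wp).1 ⟨_, hzX⟩ -
      2 * wp.1 ⟨_, hzX⟩)
    rw [lam4_apply, lam6_apply, u_apply, d4, d6]
    ring

theorem du_du_du_wp : du (du (du wp)) = 12 * wp * du wp := by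
  rw [du_du_wp]
  simp only [map_add, Derivation.leibniz, Derivation.leibniz_pow, smul_eq_mul, nsmul_eq_mul,
    derivation_ofNat, du_lam4, Nat.add_one_sub_one, pow_one]
  push_cast
  ring

theorem L2_wp : L2 wp = 2 * third * du (du wp) - 2 * wp ^ 2 := by
  refine sub_eq_zero.1 (eq_zero_of_du_mul_eq ?_ fun a b hab => ?_)
  · have h1 := congrArg L2 du_wp_sq
    simp only [map_add, Derivation.leibniz, Derivation.leibniz_pow, smul_eq_mul, nsmul_eq_mul,
      L2_lam4, L2_lam6, L2_du, derivation_ofNat, Nat.add_one_sub_one, pow_one] at h1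
    push_cast at h1
    simp only [map_sub, Derivation.leibniz, Derivation.leibniz_pow, derivation_ofNat,
      derivation_third, smul_eq_mul, nsmul_eq_mul, du_du_du_wp, Nat.add_one_sub_one, pow_one]
    push_cast
    refine two_mul_cancel ?_
    rw [du_du_wp]
    linear_combination h1 + (10 - 48 * third) * wp * du_wp_sq -
      (16 * wp ^ 4 + 32 * lam4 * wp ^ 2 + 64 * wp * lam6) * three_mul_third
  · have h4 := (tendsto_slice_partialD_wp hab (1, 0)).const_mul (6 * b)
    have h6 := (tendsto_slice_partialD_wp hab (0, 1)).const_mul (-(4 / 3) * a ^ 2)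
    have h := (h4.add h6).add (tendsto_except_two (periods a b))
    simp only [mul_zero, add_zero] at h
    refine h.congr' ?_
    filter_upwards [eventually_mem_smallSet hab] with z hz
    have hzX : (z, a, b) ∈ X := mem_X (smallSet_subset hz)
    rw [← slice_wp hzX, ← slice_du_wp hzX, ← slice_zeta hzX, (periods_spec hab).1, L2_apply,
      du_du_wp]
    simp only [slice_apply _ hzX]
    change _ = z ^ 3 * (6 * lam6.1 ⟨_, hzX⟩ * (d4 wp).1 ⟨_, hzX⟩ -
      4 * (1 / 3) * lam4.1 ⟨_, hzX⟩ ^ 2 * (d6 wp).1 ⟨_, hzX⟩ -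
      zeta.1 ⟨_, hzX⟩ * (du wp).1 ⟨_, hzX⟩ -
      (2 * (1 / 3) * (6 * wp.1 ⟨_, hzX⟩ ^ 2 + 2 * lam4.1 ⟨_, hzX⟩) - 2 * wp.1 ⟨_, hzX⟩ ^ 2))
    rw [lam4_apply, lam6_apply, d4, d6]
    ring

theorem L0_du_wp : L0 (du wp) = 3 * du wp := by
  rw [L0_du, L0_wp, Derivation.leibniz, derivation_ofNat, smul_eq_mul, smul_eq_mul]
  ring

theorem L0_du_du_wp : L0 (du (du wp)) = 4 * du (du wp) := by
  rw [L0_du, L0_du_wp, Derivation.leibniz, derivation_ofNat, smul_eq_mul, smul_eq_mul]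
  ring

/-- A formal computation with `L0 ζ` left unknown: the `λ`-parts already match, so the whole defect
is one coefficient of `∂`. -/
theorem lie_L0_L2_apply (f : O) : ⁅L0, L2⁆ f = 2 * L2 f + (zeta - L0 zeta) * du f := by
  rw [Derivation.commutator_apply]
  simp only [L0_apply, L2_apply, map_add, map_sub, Derivation.leibniz, Derivation.leibniz_pow,
    smul_eq_mul, nsmul_eq_mul, derivation_ofNat, derivation_third, du_lam4, du_lam6, d4_lam4,
    d4_lam6, d6_lam4, d6_lam6, du_u, d4_u, d6_u, du_d4, du_d6, d4_d6, du_zeta]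
  push_cast
  ring

/-- The bracket acts on `℘` in a way already known from `L0_wp` and `L2_wp`. Comparison gives `(ζ -
L0 ζ)℘' = 0`, and `℘'` cancels. -/
theorem L0_zeta : L0 zeta = zeta := by
  have h1 := lie_L0_L2_apply wp
  rw [Derivation.commutator_apply, L2_wp, L0_wp] at h1
  simp only [map_sub, Derivation.leibniz, Derivation.leibniz_pow, derivation_ofNat,
    derivation_third, smul_eq_mul, nsmul_eq_mul, L0_wp, L0_du_du_wp, L2_wp] at h1
  push_cast at h1
  refine (sub_eq_zero.1 (eq_zero_of_mul_du_wp ?_)).symm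
  linear_combination -h1


end Actions
end EllipticDer

namespace EllipticDer
open MvPolynomial

/-! ### The ring `𝒫₁` -/

section Ring

theorem iterate_mem_P1 (i : ℕ) : du^[i] wp ∈ P1 := Algebra.subset_adjoin ⟨i, rfl⟩

theorem wp_mem : wp ∈ P1 := iterate_mem_P1 0
theorem du_wp_mem : du wp ∈ P1 := iterate_mem_P1 1
theorem du_du_wp_mem : du (du wp) ∈ P1 := iterate_mem_P1 2
theorem third_mem : third ∈ P1 := P1.algebraMap_mem _
theorem ofNat_mem_P1 (n : ℕ) [n.AtLeastTwo] : (ofNat(n) : O) ∈ P1 := _root_.ofNat_mem P1 n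

/-- The constant function `1 / 2`. -/
noncomputable def half : O := algebraMap ℂ O (1 / 2)

theorem half_mem : half ∈ P1 := P1.algebraMap_mem _

theorem two_mul_half : 2 * half = 1 := by
  rw [half, ← map_ofNat (algebraMap ℂ O) 2, ← map_mul]
  norm_num

theorem lam4_mem : lam4 ∈ P1 := by
  have h : lam4 = half * (du (du wp) - 6 * wp ^ 2) := by
    rw [du_du_wp]
    linear_combination -lam4 * two_mul_half
  rw [h]
  exact mul_mem half_mem (sub_mem du_du_wp_mem (mul_mem (ofNat_mem_P1 6) (pow_mem wp_mem 2)))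

theorem lam6_mem : lam6 ∈ P1 := by
  have h : lam6 = half ^ 2 * du wp ^ 2 - wp ^ 3 - lam4 * wp := by
    rw [du_wp_sq]
    linear_combination -(2 * half + 1) * (wp ^ 3 + lam4 * wp + lam6) * two_mul_half
  rw [h]
  exact sub_mem (sub_mem (mul_mem (pow_mem half_mem 2) (pow_mem du_wp_mem 2)) (pow_mem wp_mem 3))
    (mul_mem lam4_mem wp_mem)

theorem disc_mem : disc ∈ P1 :=
  add_mem (mul_mem (ofNat_mem_P1 4) (pow_mem lam4_mem 3))
    (mul_mem (ofNat_mem_P1 27) (pow_mem lam6_mem 2))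

theorem derivation_mem_adjoin {s : Set O} {D : Derivation ℂ O O}
    (h : ∀ f ∈ s, D f ∈ Algebra.adjoin ℂ s) {f : O} (hf : f ∈ Algebra.adjoin ℂ s) :
    D f ∈ Algebra.adjoin ℂ s := by
  induction hf using Algebra.adjoin_induction with
  | mem f hf => exact h f hf
  | algebraMap r => rw [D.map_algebraMap]; exact zero_mem _
  | add f g _ _ hf hg => rw [map_add]; exact add_mem hf hg
  | mul f g hf' hg' hf hg =>
    rw [D.leibniz, smul_eq_mul, smul_eq_mul]
    exact add_mem (mul_mem hf' hg) (mul_mem hg' hf)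

/-- `𝒫₁` is generated by `℘`, `℘'` and `λ₄`. -/
theorem P1_eq_adjoin : P1 = Algebra.adjoin ℂ {wp, du wp, lam4} := by
  set A := Algebra.adjoin ℂ ({wp, du wp, lam4} : Set O) with hA
  have h1 : wp ∈ A := Algebra.subset_adjoin (by simp)
  have h2 : du wp ∈ A := Algebra.subset_adjoin (by simp)
  have h3 : lam4 ∈ A := Algebra.subset_adjoin (by simp)
  refine le_antisymm (Algebra.adjoin_le ?_) (Algebra.adjoin_le ?_)
  · rintro _ ⟨i, rfl⟩
    induction i with
    | zero => exact h1
    | succ i ih =>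
      simp only [Function.iterate_succ_apply'] at ih ⊢
      refine derivation_mem_adjoin ?_ ih
      rintro f (rfl | rfl | rfl)
      · exact h2
      · rw [du_du_wp]
        exact add_mem (mul_mem (_root_.ofNat_mem A 6) (pow_mem h1 2))
          (mul_mem (_root_.ofNat_mem A 2) h3)
      · rw [du_lam4]
        exact zero_mem _
  · rintro f (rfl | rfl | rfl)
    exacts [wp_mem, du_wp_mem, lam4_mem]

theorem derivation_mem_P1 {D : Derivation ℂ O O} (h1 : D wp ∈ P1) (h2 : D (du wp) ∈ P1)
    (h3 : D lam4 ∈ P1) {f : O} (hf : f ∈ P1) : D f ∈ P1 := by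
  rw [P1_eq_adjoin] at h1 h2 h3 hf ⊢
  refine derivation_mem_adjoin ?_ hf
  rintro f (rfl | rfl | rfl)
  exacts [h1, h2, h3]

theorem L1_mem {f : O} (hf : f ∈ P1) : du f ∈ P1 :=
  derivation_mem_P1 du_wp_mem du_du_wp_mem (by rw [du_lam4]; exact zero_mem _) hf

theorem L0_mem {f : O} (hf : f ∈ P1) : L0 f ∈ P1 := by
  refine derivation_mem_P1 ?_ ?_ ?_ hf
  · rw [L0_wp]; exact mul_mem (ofNat_mem_P1 2) wp_mem
  · rw [L0_du_wp]; exact mul_mem (ofNat_mem_P1 3) du_wp_mem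
  · rw [L0_lam4]; exact mul_mem (ofNat_mem_P1 4) lam4_mem

theorem L2_wp_mem : L2 wp ∈ P1 := by
  rw [L2_wp]
  exact sub_mem (mul_mem (mul_mem (ofNat_mem_P1 2) third_mem) du_du_wp_mem)
    (mul_mem (ofNat_mem_P1 2) (pow_mem wp_mem 2))

theorem L2_mem {f : O} (hf : f ∈ P1) : L2 f ∈ P1 := by
  refine derivation_mem_P1 L2_wp_mem ?_ ?_ hf
  · rw [L2_du]; exact sub_mem (L1_mem L2_wp_mem) (mul_mem wp_mem du_wp_mem)
  · rw [L2_lam4]; exact mul_mem (ofNat_mem_P1 6) lam6_mem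

/-- Division with remainder by one generator. It is applied with `a = ℘'` and with `a = λ₄`, where
the remainder is then tested on the zero set of `a`. -/
theorem exists_eq_mul_add_aeval {a x y f : O} (hf : f ∈ Algebra.adjoin ℂ {a, x, y}) :
    ∃ g ∈ Algebra.adjoin ℂ {a, x, y}, ∃ q : MvPolynomial (Fin 2) ℂ,
      f = a * g + aeval ![x, y] q := by
  set A := Algebra.adjoin ℂ ({a, x, y} : Set O) with hA
  have ha : a ∈ A := Algebra.subset_adjoin (by simp)
  have hq : ∀ q : MvPolynomial (Fin 2) ℂ, aeval ![x, y] q ∈ A := fun q => by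
    have h : aeval ![x, y] q ∈ Algebra.adjoin ℂ (Set.range ![x, y]) := by
      rw [Algebra.adjoin_range_eq_range_aeval]
      exact ⟨q, rfl⟩
    refine Algebra.adjoin_mono ?_ h
    rintro _ ⟨i, rfl⟩
    fin_cases i <;> simp
  induction hf using Algebra.adjoin_induction with
  | mem f hf =>
    rcases hf with rfl | rfl | rfl
    · exact ⟨1, one_mem _, 0, by simp⟩
    · exact ⟨0, zero_mem _, MvPolynomial.X 0, by simp⟩
    · exact ⟨0, zero_mem _, MvPolynomial.X 1, by simp⟩
  | algebraMap r => exact ⟨0, zero_mem _, C r, by simp⟩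
  | add f g _ _ hf hg =>
    obtain ⟨f1, hf1, q1, e1⟩ := hf
    obtain ⟨g1, hg1, q2, e2⟩ := hg
    refine ⟨f1 + g1, add_mem hf1 hg1, q1 + q2, ?_⟩
    rw [e1, e2, map_add]
    ring
  | mul f g _ hg' hf hg =>
    obtain ⟨f1, hf1, q1, e1⟩ := hf
    obtain ⟨g1, hg1, q2, e2⟩ := hg
    refine ⟨f1 * g + aeval ![x, y] q1 * g1, add_mem (mul_mem hf1 hg') (mul_mem (hq q1) hg1),
      q1 * q2, ?_⟩
    rw [map_mul]
    linear_combination g * e1 + aeval ![x, y] q1 * e2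

theorem aeval_apply (x y : O) (q : MvPolynomial (Fin 2) ℂ) (p : X) :
    (aeval ![x, y] q).1 p = eval ![x.1 p, y.1 p] q := by
  let ev : O →ₐ[ℂ] ℂ := (Pi.evalAlgHom ℂ (fun _ : X => ℂ) p).comp (Holo X).val
  change ev (aeval ![x, y] q) = _
  have h : (fun i => ev (![x, y] i)) = ![x.1 p, y.1 p] := by
    ext i
    fin_cases i <;> rfl
  rw [← AlgHom.comp_apply, comp_aeval, h, ← MvPolynomial.coe_aeval_eq_eval]
  rfl

theorem eq_zero_of_mul_eval {q r : MvPolynomial (Fin 2) ℂ} (hr : r ≠ 0)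
    (h : ∀ v, eval v r ≠ 0 → eval v q = 0) : q = 0 := by
  have h1 : q * r = 0 := MvPolynomial.funext fun v => by
    rw [map_mul, map_zero]
    by_cases hv : eval v r = 0
    · rw [hv, mul_zero]
    · rw [h v hv, zero_mul]
  exact (mul_eq_zero.1 h1).resolve_right hr

/-- Write `γ℘' = ℘'g + q(℘, λ₄)`. Then `q` vanishes wherever `℘' = 0`, and these points realise
every pair `(x, λ₄)` outside a discriminant curve; so `q = 0` and `γ = g`. -/
theorem mem_P1_of_mul_du_wp {γ : O} (h : γ * du wp ∈ P1) : γ ∈ P1 := by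
  have hset : ({wp, du wp, lam4} : Set O) = {du wp, wp, lam4} := Set.insert_comm _ _ _
  rw [P1_eq_adjoin, hset] at h
  obtain ⟨g, hg, q, e⟩ := exists_eq_mul_add_aeval h
  rw [← hset, ← P1_eq_adjoin] at hg
  have hq : q = 0 := by
    -- The discriminant of the curve with `λ₄ = v 1` passing through `(v 0, 0)`, which forces `λ₆ =
    -- -(x³ + λ₄x)`.
    refine eq_zero_of_mul_eval (r := 4 * MvPolynomial.X 1 ^ 3 +
      27 * (MvPolynomial.X 0 ^ 3 + MvPolynomial.X 1 * MvPolynomial.X 0) ^ 2) ?_ fun v hv => ?_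
    · intro h0
      have := congrArg (eval ![1, 0]) h0
      simp at this
    · simp only [map_add, map_mul, map_pow, eval_X, map_ofNat] at hv
      obtain ⟨p, h1, h2, h3, h4⟩ := exists_point (a := v 1) (b := -(v 0 ^ 3 + v 1 * v 0))
        (x := v 0) (y := 0) (by rw [IsNonsingular, neg_sq]; exact hv) (by ring)
      have h5 : γ.1 p * (du wp).1 p = (du wp).1 p * g.1 p + (aeval ![wp, lam4] q).1 p :=
        congrArg (fun f : O => f.1 p) e
      rw [aeval_apply, h1, h2, h3] at h5
      have hv2 : v = ![v 0, v 1] := by ext i; fin_cases i <;> rfl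
      rw [hv2]
      linear_combination -h5
  rw [hq, map_zero] at e
  have : γ - g = 0 := eq_zero_of_mul_du_wp (by linear_combination e)
  rw [sub_eq_zero.1 this]
  exact hg

/-- Modulo `λ₄` an element of `P1` is a polynomial in `℘` and `℘'`. On the curves with `λ₄ = 0` the
pair takes all values with `y² ≠ 4x³`, so that polynomial vanishes. -/
theorem exists_eq_lam4_mul {c : O} (hc : c ∈ P1) (h : ∀ p : X, lam4.1 p = 0 → c.1 p = 0) :
    ∃ g ∈ P1, c = lam4 * g := by
  have hset : ({wp, du wp, lam4} : Set O) = {lam4, wp, du wp} := by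
    ext f
    simp only [Set.mem_insert_iff, Set.mem_singleton_iff]
    tauto
  rw [P1_eq_adjoin, hset] at hc
  obtain ⟨g, hg, q, e⟩ := exists_eq_mul_add_aeval hc
  rw [← hset, ← P1_eq_adjoin] at hg
  refine ⟨g, hg, ?_⟩
  have hq : q = 0 := by
    refine eq_zero_of_mul_eval (r := MvPolynomial.X 1 ^ 2 - 4 * MvPolynomial.X 0 ^ 3) ?_
      fun v hv => ?_
    · intro h0
      have := congrArg (eval ![1, 0]) h0
      simp at this
    · simp only [map_sub, map_mul, map_pow, eval_X, map_ofNat] at hv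
      obtain ⟨p, h1, h2, h3, h4⟩ := exists_point (a := 0) (b := (v 1 ^ 2 - 4 * v 0 ^ 3) / 4)
        (x := v 0) (y := v 1) (by
          have : (v 1 ^ 2 - 4 * v 0 ^ 3) / 4 ≠ 0 := div_ne_zero hv (by norm_num)
          simpa [IsNonsingular] using hv) (by ring)
      have h5 : c.1 p = lam4.1 p * g.1 p + (aeval ![wp, du wp] q).1 p :=
        congrArg (fun f : O => f.1 p) e
      rw [aeval_apply, h1, h2, h3, h p h3] at h5
      have hv2 : v = ![v 0, v 1] := by ext i; fin_cases i <;> rfl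
      rw [hv2]
      linear_combination -h5
  rw [e, hq, map_zero, add_zero]

/-- The coefficients of the operators that annihilate the discriminant. -/
theorem exists_of_disc_eq_zero {b c : O} (hc : c ∈ P1)
    (h : 2 * (lam4 ^ 2 * b) = -(9 * (lam6 * c))) :
    ∃ g ∈ P1, b = 6 * lam6 * g ∧ c = -(4 * third * lam4 ^ 2 * g) := by
  have h6 : ∀ p : X, lam4.1 p = 0 → lam6.1 p ≠ 0 := fun p h4 h6 =>
    disc_apply_ne_zero p (by rw [h4, h6]; norm_num)
  -- `λ₆ ≠ 0` where `λ₄ = 0`, so `c` vanishes there. Extracting `λ₄` twice cancels the `λ₄²` in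
  -- front of `b`.
  obtain ⟨c1, hc1, e1⟩ := exists_eq_lam4_mul hc fun p hp => by
    have h1 : 2 * (lam4.1 p ^ 2 * b.1 p) = -(9 * (lam6.1 p * c.1 p)) :=
      congrArg (fun f : O => f.1 p) h
    rw [hp] at h1
    have := h6 p hp
    simpa [this] using h1
  have h1 : 2 * (lam4 * b) = -(9 * (lam6 * c1)) := by
    refine sub_eq_zero.1 (eq_zero_of_mul_lam4 ?_)
    rw [e1] at h
    linear_combination h
  obtain ⟨c2, hc2, e2⟩ := exists_eq_lam4_mul hc1 fun p hp => by
    have h1 : 2 * (lam4.1 p * b.1 p) = -(9 * (lam6.1 p * c1.1 p)) :=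
      congrArg (fun f : O => f.1 p) h1
    rw [hp] at h1
    have := h6 p hp
    simpa [this] using h1
  have h2 : 2 * b = -(9 * (lam6 * c2)) := by
    refine sub_eq_zero.1 (eq_zero_of_mul_lam4 ?_)
    rw [e2] at h1
    linear_combination h1
  refine ⟨-(3 * half ^ 2 * c2), neg_mem (mul_mem (mul_mem (ofNat_mem_P1 3) (pow_mem half_mem 2)) hc2),
    two_mul_cancel ?_, ?_⟩
  · linear_combination h2 + 9 * lam6 * c2 * (2 * half + 1) * two_mul_half
  · rw [e1, e2]
    linear_combination -lam4 ^ 2 * c2 * (4 * half ^ 2) * three_mul_third -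
      lam4 ^ 2 * c2 * (2 * half + 1) * two_mul_half

end Ring

/-! ### The modules `Der` and `ℒ₁` -/

section Modules

theorem L0_disc : L0 disc = 12 * disc := by
  simp only [disc, map_add, Derivation.leibniz, Derivation.leibniz_pow, smul_eq_mul, nsmul_eq_mul,
    derivation_ofNat, L0_lam4, L0_lam6]
  push_cast
  ring

theorem L1_disc : L1 disc = 0 := by
  simp only [disc, L1_apply, map_add, Derivation.leibniz, Derivation.leibniz_pow, smul_eq_mul,
    nsmul_eq_mul, derivation_ofNat, du_lam4, du_lam6]
  ring

theorem L2_disc : L2 disc = 0 := by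
  simp only [disc, map_add, Derivation.leibniz, Derivation.leibniz_pow, smul_eq_mul, nsmul_eq_mul,
    derivation_ofNat, L2_lam4, L2_lam6]
  push_cast
  linear_combination -72 * lam4 ^ 2 * lam6 * three_mul_third

theorem L0_mem_lieP1 : L0 ∈ lieP1 := by
  refine ⟨⟨⟨-u, 4 * lam4, 6 * lam6, ?_⟩, fun f hf => L0_mem hf⟩, 12, ofNat_mem_P1 12, L0_disc⟩
  ext1 f
  change L0 f = -u * du f + 4 * lam4 * d4 f + 6 * lam6 * d6 f
  rw [L0_apply]
  ring

theorem L1_mem_lieP1 : L1 ∈ lieP1 := by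
  refine ⟨⟨⟨1, 0, 0, ?_⟩, fun f hf => L1_mem hf⟩, 0, zero_mem _, by rw [L1_disc, zero_mul]⟩
  simp [L1]

theorem L2_mem_lieP1 : L2 ∈ lieP1 := by
  refine ⟨⟨⟨-zeta, 6 * lam6, -(4 * third * lam4 ^ 2), ?_⟩, fun f hf => L2_mem hf⟩, 0, zero_mem _,
    by rw [L2_disc, zero_mul]⟩
  ext1 f
  change L2 f = -zeta * du f + 6 * lam6 * d4 f + -(4 * third * lam4 ^ 2) * d6 f
  rw [L2_apply]
  ring

theorem mem_span_of_eq {D : Derivation ℂ O O} {α β γ : O} (hα : α ∈ P1) (hβ : β ∈ P1)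
    (hγ : γ ∈ P1) (h : ∀ f, D f = α * L0 f + γ * L1 f + β * L2 f) :
    D ∈ Submodule.span P1 {L0, L1, L2} := by
  refine Submodule.mem_span_triple.2 ⟨⟨α, hα⟩, ⟨γ, hγ⟩, ⟨β, hβ⟩, ?_⟩
  ext1 f
  exact (h f).symm

theorem lieP1_eq_span : lieP1 = Submodule.span P1 {L0, L1, L2} := by
  refine le_antisymm ?_ (Submodule.span_le.2 ?_)
  · rintro D ⟨⟨⟨a, b, c, rfl⟩, hD⟩, g, hg, hdisc⟩
    have happ : ∀ f, (a • du + b • d4 + c • d6) f = a * du f + b * d4 f + c * d6 f := fun f => rfl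
    simp only [happ] at hD hdisc
    have hc : c ∈ P1 := by simpa using hD lam6 lam6_mem
    -- This is `g/12`: since `L0` multiplies the discriminant by `12`, subtracting `k L0` leaves an
    -- operator that kills it.
    set k : O := third * half ^ 2 * g with hk
    have hkm : k ∈ P1 := mul_mem (mul_mem third_mem (pow_mem half_mem 2)) hg
    have hkg : 12 * k = g := by
      rw [hk]
      linear_combination 4 * half ^ 2 * g * three_mul_third + g * (2 * half + 1) * two_mul_half
    have hdisc' : 12 * lam4 ^ 2 * b + 54 * lam6 * c = g * (4 * lam4 ^ 3 + 27 * lam6 ^ 2) := by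
      rw [disc] at hdisc
      simp only [map_add, Derivation.leibniz, Derivation.leibniz_pow, smul_eq_mul, nsmul_eq_mul,
        derivation_ofNat, du_lam4, du_lam6, d4_lam4, d4_lam6, d6_lam4, d6_lam6] at hdisc
      push_cast at hdisc
      linear_combination hdisc
    obtain ⟨h, hh, hb', hc'⟩ := exists_of_disc_eq_zero (b := b - 4 * lam4 * k)
      (c := c - 6 * lam6 * k)
      (sub_mem hc (mul_mem (mul_mem (ofNat_mem_P1 6) lam6_mem) hkm)) (by
        have h6 : 3 * (2 * (2 * (lam4 ^ 2 * (b - 4 * lam4 * k)))) =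
            3 * (2 * -(9 * (lam6 * (c - 6 * lam6 * k)))) := by
          linear_combination hdisc' - (4 * lam4 ^ 3 + 27 * lam6 ^ 2) * hkg
        have h3 : ∀ {x y : O}, 3 * x = 3 * y → x = y := fun {x y} e => by
          linear_combination third * e - (x - y) * three_mul_third
        exact two_mul_cancel (h3 h6))
    -- The `∂`-coefficient left over once the `-ku` of `k L0` and the `-hζ` of `h L2` are removed.
    -- Although `u` and `ζ` appear in it, it lies in `P1`, because `γ℘'` does.
    set γ : O := a + k * u + h * zeta with hγ
    have hform : ∀ f, a * du f + b * d4 f + c * d6 f = k * L0 f + γ * L1 f + h * L2 f := fun f => by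
      rw [L0_apply, L1_apply, L2_apply, hγ]
      linear_combination d4 f * hb' + d6 f * hc'
    refine mem_span_of_eq hkm hh (mem_P1_of_mul_du_wp ?_) hform
    have h1 := hD wp wp_mem
    rw [hform] at h1
    have h2 : γ * du wp = k * L0 wp + γ * L1 wp + h * L2 wp - k * L0 wp - h * L2 wp := by
      rw [L1_apply]
      ring
    rw [h2]
    exact sub_mem (sub_mem h1 (mul_mem hkm (L0_mem wp_mem))) (mul_mem hh L2_wp_mem)
  · rintro D (rfl | rfl | rfl)
    exacts [L0_mem_lieP1, L1_mem_lieP1, L2_mem_lieP1]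

theorem disc_smul_mem_span {D : Derivation ℂ O O} (hD : D ∈ derP1) :
    disc • D ∈ Submodule.span P1 {L0, L1, L2} := by
  obtain ⟨⟨a, b, c, rfl⟩, hD⟩ := hD
  have happ : ∀ f, (a • du + b • d4 + c • d6) f = a * du f + b * d4 f + c * d6 f := fun f => rfl
  have happ' : ∀ f, (disc • (a • du + b • d4 + c • d6)) f =
    disc * (a * du f + b * d4 f + c * d6 f) := fun f => rfl
  simp only [happ] at hD
  have hb : b ∈ P1 := by simpa using hD lam4 lam4_mem
  have hc : c ∈ P1 := by simpa using hD lam6 lam6_mem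
  -- Cramer's rule for the `λ`-parts of `L0` and `L2`, whose determinant is `-(4/3)Δ`: this `α` and
  -- `β` solve `4λ₄α + 6λ₆β = Δb` and `6λ₆α - (4/3)λ₄²β = Δc`.
  set α : O := lam4 ^ 2 * b + 9 * half * lam6 * c with hα
  set β : O := 9 * half * lam6 * b - 3 * lam4 * c with hβ
  set γ : O := disc * a + α * u + β * zeta with hγ
  have h9 : 9 * half * lam6 ∈ P1 := mul_mem (mul_mem (ofNat_mem_P1 9) half_mem) lam6_mem
  have hαm : α ∈ P1 := add_mem (mul_mem (pow_mem lam4_mem 2) hb) (mul_mem h9 hc)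
  have hβm : β ∈ P1 := sub_mem (mul_mem h9 hb) (mul_mem (mul_mem (ofNat_mem_P1 3) lam4_mem) hc)
  have hform : ∀ f, disc * (a * du f + b * d4 f + c * d6 f) = α * L0 f + γ * L1 f + β * L2 f :=
    fun f => by
      rw [L0_apply, L1_apply, L2_apply, hγ, hα, hβ, disc]
      linear_combination
        -(27 * lam6 ^ 2 * b + 18 * lam4 * lam6 * c) * d4 f * two_mul_half +
        (-4 * lam4 ^ 3 * c + 12 * half * lam6 * lam4 ^ 2 * b) * d6 f * three_mul_third +
        (6 * lam6 * lam4 ^ 2 * b - 27 * lam6 ^ 2 * c) * d6 f * two_mul_half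
  refine mem_span_of_eq hαm hβm (mem_P1_of_mul_du_wp ?_) fun f => (happ' f).trans (hform f)
  have h1 := mul_mem disc_mem (hD wp wp_mem)
  rw [hform] at h1
  have h2 : γ * du wp = α * L0 wp + γ * L1 wp + β * L2 wp - α * L0 wp - β * L2 wp := by
    rw [L1_apply]
    ring
  rw [h2]
  exact sub_mem (sub_mem h1 (mul_mem hαm (L0_mem wp_mem))) (mul_mem hβm L2_wp_mem)

/-- The second-order terms cancel because the partial derivatives commute, and on the discriminant
the two `gg'` terms cancel, leaving the factor `D g' - D' g`. -/
theorem lie_mem_lieP1 {D D' : Derivation ℂ O O} (hD : D ∈ lieP1) (hD' : D' ∈ lieP1) :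
    ⁅D, D'⁆ ∈ lieP1 := by
  obtain ⟨⟨⟨a, b, c, e⟩, hP⟩, g, hg, hd⟩ := hD
  obtain ⟨⟨⟨a', b', c', e'⟩, hP'⟩, g', hg', hd'⟩ := hD'
  have happ : ∀ f, D f = a * du f + b * d4 f + c * d6 f := fun f => by rw [e]; rfl
  have happ' : ∀ f, D' f = a' * du f + b' * d4 f + c' * d6 f := fun f => by rw [e']; rfl
  refine ⟨⟨⟨D a' - D' a, D b' - D' b, D c' - D' c, ?_⟩, fun f hf => ?_⟩, D g' - D' g,
    sub_mem (hP g' hg') (hP' g hg), ?_⟩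
  · ext1 f
    change ⁅D, D'⁆ f = (D a' - D' a) * du f + (D b' - D' b) * d4 f + (D c' - D' c) * d6 f
    rw [Derivation.commutator_apply]
    simp only [happ, happ', map_add, Derivation.leibniz, smul_eq_mul, du_d4, du_d6, d4_d6]
    ring
  · rw [Derivation.commutator_apply]
    exact sub_mem (hP _ (hP' f hf)) (hP' _ (hP f hf))
  · rw [Derivation.commutator_apply, hd, hd', D.leibniz, D'.leibniz, hd, hd']
    simp only [smul_eq_mul]
    ring

theorem lie_L0_L1 : ⁅L0, L1⁆ = L1 := by
  ext1 f
  rw [Derivation.commutator_apply, L1_apply, L1_apply, L0_du]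
  ring

theorem lie_L0_L2 : ⁅L0, L2⁆ = (2 : ℂ) • L2 := by
  ext1 f
  rw [lie_L0_L2_apply, L0_zeta, sub_self, zero_mul, add_zero, Derivation.smul_apply, two_smul,
    two_mul]

theorem lie_L1_L2 : ⁅L1, L2⁆ = wp • L1 := by
  ext1 f
  change _ = wp * du f
  rw [Derivation.commutator_apply, L1_apply, L1_apply, L2_du]
  ring

end Modules
end EllipticDer

theorem mainTheorem8 :
    -- the functions `℘(u; λ)` and `ζ(u; λ)` are well defined and holomorphic
    (∀ l4 l6 : ℂ, EllipticDer.IsNonsingular l4 l6 →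
      EllipticDer.IsPeriodPairOf (EllipticDer.periods l4 l6) l4 l6) ∧
    IsOpen EllipticDer.regSet ∧
    AnalyticOnNhd ℂ EllipticDer.wpFun EllipticDer.regSet ∧
    AnalyticOnNhd ℂ EllipticDer.zetaFun EllipticDer.regSet ∧
    EllipticDer.du EllipticDer.zeta = -EllipticDer.wp ∧
    -- the Lie algebra and its generators
    (∀ D ∈ EllipticDer.lieP1, ∀ D' ∈ EllipticDer.lieP1, ⁅D, D'⁆ ∈ EllipticDer.lieP1) ∧
    EllipticDer.lieP1 =
      Submodule.span EllipticDer.P1 {EllipticDer.L0, EllipticDer.L1, EllipticDer.L2} ∧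
    (∀ D ∈ EllipticDer.derP1, EllipticDer.disc • D ∈
      Submodule.span EllipticDer.P1 {EllipticDer.L0, EllipticDer.L1, EllipticDer.L2}) ∧
    -- the brackets
    ⁅EllipticDer.L0, EllipticDer.L1⁆ = EllipticDer.L1 ∧
    ⁅EllipticDer.L0, EllipticDer.L2⁆ = (2 : ℂ) • EllipticDer.L2 ∧
    ⁅EllipticDer.L1, EllipticDer.L2⁆ = EllipticDer.wp • EllipticDer.L1 ∧
    -- the action on `℘`
    EllipticDer.L0 EllipticDer.wp = 2 * EllipticDer.wp ∧
    EllipticDer.L1 EllipticDer.wp = EllipticDer.du EllipticDer.wp ∧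
    EllipticDer.L2 EllipticDer.wp =
      (2 / 3 : ℂ) • EllipticDer.du (EllipticDer.du EllipticDer.wp) -
        2 * EllipticDer.wp ^ 2 := by
  refine ⟨fun l4 l6 h => EllipticDer.periods_spec h, EllipticDer.isOpen_regSet,
    EllipticDer.analyticOnNhd_wpFun, EllipticDer.analyticOnNhd_zetaFun, EllipticDer.du_zeta,
    fun D hD D' hD' => EllipticDer.lie_mem_lieP1 hD hD', EllipticDer.lieP1_eq_span,
    fun D hD => EllipticDer.disc_smul_mem_span hD, EllipticDer.lie_L0_L1, EllipticDer.lie_L0_L2,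
    EllipticDer.lie_L1_L2, EllipticDer.L0_wp, rfl, ?_⟩
  rw [EllipticDer.smul_eq_third]
  exact EllipticDer.L2_wp
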